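/- Let $B$ be a real symmetric invertible $3\times 3$ matrix, let $Q(v)=vBv^{T}$, $v=(x_1,x_2,x_3)$, be the corresponding nondegenerate quadratic form, and let $\Delta_Q=\sum_{i,j}b^{ij}\partial_i\partial_j$, where $(b^{ij})=B^{-1}$. Let $V(d;\mathbb R)$ be the space of real homogeneous polynomials of degree $d$ in $x_1,x_2,x_3$, let $\mathrm{Har}_Q(d;\mathbb R)=V(d;\mathbb R)\cap\ker\Delta_Q$, and let $O_Q(3;\mathbb R)=\{U\in GL(3;\mathbb R): UBU^{T}=B\}$ act on polynomials by $P(v)\mapsto P(vU)$. For a complex matrix $A$ with $AA^{T}=B$ put $$\langle f,g\rangle_A=\operatorname{Re}\int_{S^2} f(vA^{-1})\,\overline{g(vA^{-1})}\,dm(v),$$ where $dm$ is the standard measure on the real unit sphere $S^2$. 1. For every $d\ge 0$ there is a direct sum decomposition $V(d;\mathbb R)=\bigoplus_{0\le k\le d/2}Q^k\cdot \mathrm{Har}_Q(d-2k;\mathbb R)$. Each summand is $O_Q(3;\mathbb R)$-invariant, and distinct summands are orthogonal with respect to $\langle\cdot,\cdot\rangle_A$ for every such $A$. 2. For every $c\in\mathbb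 R$ and every real polynomial $F$ there is a real polynomial $P$ with $\Delta_Q P=0$ that coincides with $F$ on $\{v\in\mathbb R^3: Q(v)=c\}$. 3. For every $c\in\mathbb R$ and all real polynomials $M$ and $N$, the Dirichlet problem $\Delta_Q P=M$, $P=N$ on $\{v\in\mathbb R^3:Q(v)=c\}$, has a real polynomial solution $P$. The solution is unique if $\{v\in\mathbb R^3:Q(v)=c\}$ contains a nonzero vector. 4. For every $d\ge 0$, every $P\in V(d;\mathbb R)$ admits a representation $$P=\operatorname{Re}\Big\{\sum_{0\le k\le d/2}\lambda_k\,Q^{\,d-k+\frac12}\,\nabla_{\mathbf u_{1,k}}\nabla_{\mathbf u_{2,k}}\cdots\nabla_{\mathbf u_{d-2k,k}}\big(Q^{-\frac12}\big)\Big\}$$ with vectors $\mathbf u_{j,k}\in\mathbb C^3$, where $\lambda_k=1$ for $2k<d$, and, if $d$ is even, $\lambda_{d/2}=\lambda$ is a real number. Here $\nabla_{\mathbf u}$ is the directional derivative of holomorphic functions on open subsets of $\mathbb C^3$, and the equality holds at every $v\in\mathbb R^3$ with $Q(v)\neq 0$ and for every holomorphic branch of $Q^{1/2}$ near $v$. 5.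 If $Q$ is positive definite, the vectors $\mathbf u_{j,k}$ in 4 can be chosen in $\mathbb R^3$, and the representation with real vectors is unique in the following sense. The number $\lambda$ (for even $d$) is determined by $P$. For each $k$ with $2k<d$ the tuple $(\mathbf u_{1,k},\dots,\mathbf u_{d-2k,k})$ is determined by $P$ up to reordering and rescaling of the vectors by real factors with product $1$, all tuples that contain the zero vector being identified with each other. -/

import Mathlib

open MvPolynomial MeasureTheory
open scoped Matrix ComplexConjugate

namespace QHarm

noncomputable section

/-- The quadratic form `Q(v) = v B vᵀ` as a polynomial in three variables. -/
def quadPoly (B : Matrix (Fin 3) (Fin 3) ℝ) : MvPolynomial (Fin 3) ℝ :=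
  ∑ i, ∑ j, C (B i j) * X i * X j

/-- The operator `Δ_Q = ∑ b^{ij} ∂_i ∂_j`, where `(b^{ij}) = B⁻¹`. -/
def lapl (B : Matrix (Fin 3) (Fin 3) ℝ) :
    MvPolynomial (Fin 3) ℝ →ₗ[ℝ] MvPolynomial (Fin 3) ℝ :=
  ∑ i, ∑ j, (B⁻¹ i j) • ((pderiv i).toLinearMap ∘ₗ (pderiv j).toLinearMap)

/-- `Har_Q(n; ℝ)`: the real homogeneous polynomials of degree `n` in the kernel of `Δ_Q`. -/
def harm (B : Matrix (Fin 3) (Fin 3) ℝ) (n : ℕ) : Submodule ℝ (MvPolynomial (Fin 3) ℝ) :=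
  homogeneousSubmodule (Fin 3) ℝ n ⊓ LinearMap.ker (lapl B)

/-- `Q^k · Har_Q(d - 2k; ℝ)` (used for `2k ≤ d` only). -/
def summand (B : Matrix (Fin 3) (Fin 3) ℝ) (d k : ℕ) :
    Submodule ℝ (MvPolynomial (Fin 3) ℝ) :=
  (harm B (d - 2 * k)).map (LinearMap.mulLeft ℝ (quadPoly B ^ k))

/-- `O_Q(3; ℝ)`: the group of the invertible `U` with `U B Uᵀ = B`. -/
def orthoGroup (B : Matrix (Fin 3) (Fin 3) ℝ) : Subgroup (GL (Fin 3) ℝ) where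
  carrier := {U | (U : Matrix (Fin 3) (Fin 3) ℝ) * B * (U : Matrix (Fin 3) (Fin 3) ℝ)ᵀ = B}
  one_mem' := by simp
  mul_mem' := by
    intro U V hU hV
    simp only [Set.mem_ofPred_eq, Units.val_mul, Matrix.transpose_mul] at *
    calc (U : Matrix (Fin 3) (Fin 3) ℝ) * V * B
          * ((V : Matrix (Fin 3) (Fin 3) ℝ)ᵀ * (U : Matrix (Fin 3) (Fin 3) ℝ)ᵀ)
        = U * (V * B * (V : Matrix (Fin 3) (Fin 3) ℝ)ᵀ) * (U : Matrix (Fin 3) (Fin 3) ℝ)ᵀ := by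
          simp only [Matrix.mul_assoc]
      _ = B := by rw [hV, hU]
  inv_mem' := by
    intro U hU
    simp only [Set.mem_ofPred_eq] at *
    have h1 : ((U⁻¹ : GL (Fin 3) ℝ) : Matrix (Fin 3) (Fin 3) ℝ) * U = 1 := by
      rw [← Units.val_mul]; simp
    have h2 : (U : Matrix (Fin 3) (Fin 3) ℝ)ᵀ
        * ((U⁻¹ : GL (Fin 3) ℝ) : Matrix (Fin 3) (Fin 3) ℝ)ᵀ = 1 := by
      rw [← Matrix.transpose_mul, h1, Matrix.transpose_one]
    set W : Matrix (Fin 3) (Fin 3) ℝ := ((U⁻¹ : GL (Fin 3) ℝ) : Matrix (Fin 3) (Fin 3) ℝ)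
    calc W * B * Wᵀ = W * (U * B * (U : Matrix (Fin 3) (Fin 3) ℝ)ᵀ) * Wᵀ := by rw [hU]
      _ = (W * U) * B * ((U : Matrix (Fin 3) (Fin 3) ℝ)ᵀ * Wᵀ) := by
          simp only [Matrix.mul_assoc]
      _ = B := by rw [h1, h2]; simp

/-- The action `P(v) ↦ P(v U)` on polynomials, `v` being a row vector. -/
def act (U : Matrix (Fin 3) (Fin 3) ℝ) :
    MvPolynomial (Fin 3) ℝ →ₗ[ℝ] MvPolynomial (Fin 3) ℝ :=
  (aeval fun j => ∑ i, C (U i j) * (X i : MvPolynomial (Fin 3) ℝ)).toLinearMap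

/-- `⟨f, g⟩ = Re ∫_{S²} f(v A⁻¹) · conj (g(v A⁻¹)) dm(v)`, where `dm` is the standard surface
measure on the unit sphere `S²`. -/
def sphereInner (A : Matrix (Fin 3) (Fin 3) ℂ) (f g : MvPolynomial (Fin 3) ℝ) : ℝ :=
  (∫ v : Metric.sphere (0 : EuclideanSpace ℝ (Fin 3)) 1,
    aeval ((fun i => (((v : EuclideanSpace ℝ (Fin 3)) i : ℝ) : ℂ)) ᵥ* A⁻¹) f *
      conj (aeval ((fun i => (((v : EuclideanSpace ℝ (Fin 3)) i : ℝ) : ℂ)) ᵥ* A⁻¹) g)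
    ∂((volume : Measure (EuclideanSpace ℝ (Fin 3))).toSphere)).re

/-- `s` is a single-valued holomorphic branch of `Q^{1/2}` on the open set `W ⊆ ℂ³ ∖ {Q = 0}`. -/
structure IsSqrtBranch (B : Matrix (Fin 3) (Fin 3) ℝ) (W : Set (Fin 3 → ℂ))
    (s : (Fin 3 → ℂ) → ℂ) : Prop where
  isOpen : IsOpen W
  analytic : AnalyticOnNhd ℂ s W
  sq_eq : ∀ w ∈ W, s w ^ 2 = aeval w (quadPoly B)
  ne_zero : ∀ w ∈ W, s w ≠ 0

/-- Branches exist near every point where `Q` does not vanish. -/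
theorem exists_isSqrtBranch (B : Matrix (Fin 3) (Fin 3) ℝ) (w : Fin 3 → ℂ)
    (hw : aeval w (quadPoly B) ≠ 0) : ∃ W s, w ∈ W ∧ IsSqrtBranch B W s := by
  set q : (Fin 3 → ℂ) → ℂ := fun z => aeval z (quadPoly B) with hq
  have hqa : ∀ z, AnalyticAt ℂ q z := by
    intro z
    have : q = fun z : Fin 3 → ℂ => ∑ i, ∑ j, (B i j : ℂ) * z i * z j := by
      funext z; simp [hq, quadPoly]
    rw [this]
    have hp : ∀ i : Fin 3, AnalyticAt ℂ (fun z : Fin 3 → ℂ => z i) z := fun i =>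
      (ContinuousLinearMap.proj (R := ℂ) (φ := fun _ : Fin 3 => ℂ) i).analyticAt z
    refine Finset.analyticAt_fun_sum _ fun i _ => Finset.analyticAt_fun_sum _ fun j _ => ?_
    exact (analyticAt_const.mul (hp i)).mul (hp j)
  obtain ⟨c, hc⟩ : ∃ c : ℂ, c ^ 2 = q w := by
    obtain ⟨c, hc⟩ := IsAlgClosed.exists_pow_nat_eq (q w) (n := 2) (by norm_num)
    exact ⟨c, hc⟩
  have hc0 : c ≠ 0 := by
    rintro rfl
    exact hw (by simpa using hc.symm)
  have hqc : Continuous q := continuous_iff_continuousAt.2 fun z => (hqa z).continuousAt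
  have key : ∀ z, q z / q w ∈ Complex.slitPlane →
      (c * Complex.exp (Complex.log (q z / q w) / 2)) ^ 2 = q z := by
    intro z hz
    rw [mul_pow, ← Complex.exp_nat_mul, hc]
    have : ((2 : ℕ) : ℂ) * (Complex.log (q z / q w) / 2) = Complex.log (q z / q w) := by
      push_cast; ring
    rw [this, Complex.exp_log (Complex.slitPlane_ne_zero hz)]
    exact mul_div_cancel₀ (q z) hw
  refine ⟨{z | q z / q w ∈ Complex.slitPlane},
    fun z => c * Complex.exp (Complex.log (q z / q w) / 2), ?_, ?_, ?_, ?_, ?_⟩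
  · simp only [Set.mem_ofPred_eq]
    rw [div_self hw]
    exact Complex.one_mem_slitPlane
  · exact Complex.isOpen_slitPlane.preimage (hqc.div_const _)
  · intro z hz
    have h1 : AnalyticAt ℂ (fun z => q z / q w) z := (hqa z).div analyticAt_const hw
    exact analyticAt_const.mul ((h1.clog hz).div analyticAt_const (by norm_num)).cexp
  · exact fun z hz => key z hz
  · intro z hz
    exact mul_ne_zero hc0 (Complex.exp_ne_zero _)

/-- `∇_{u_1} ∇_{u_2} ⋯ ∇_{u_n} f` for the list `[u_1, …, u_n]` of vectors of `ℂ³`. -/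
def iterDir (us : List (Fin 3 → ℂ)) (f : (Fin 3 → ℂ) → ℂ) : (Fin 3 → ℂ) → ℂ :=
  us.foldr (fun u g w => fderiv ℂ g w u) f

/-- The sum over `0 ≤ k ≤ d/2` of `Q^{d-k+1/2} ∇_{u_{1,k}} ⋯ ∇_{u_{d-2k,k}} (Q^{-1/2})`, computed
with the branch `s` of `Q^{1/2}`. The term without any derivative, which occurs for `d = 2k`, has
the numerical coefficient `lam` (it is equal to `lam * Q^{d/2}`). -/
def maxwellSum (d : ℕ) (u : (k : ℕ) → Fin (d - 2 * k) → Fin 3 → ℂ) (lam : ℝ)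
    (s : (Fin 3 → ℂ) → ℂ) (w : Fin 3 → ℂ) : ℂ :=
  ∑ k ∈ Finset.range (d / 2 + 1),
    (if 2 * k = d then (lam : ℂ) else 1) * s w ^ (2 * (d - k) + 1) *
      iterDir (List.ofFn (u k)) (fun z => (s z)⁻¹) w

/-- `P` is the real part of the Maxwell-type sum, at each real point off the cone `{Q = 0}` and for
each branch of `Q^{1/2}` around the point. -/
def MaxwellRep (B : Matrix (Fin 3) (Fin 3) ℝ) (d : ℕ) (P : MvPolynomial (Fin 3) ℝ)
    (u : (k : ℕ) → Fin (d - 2 * k) → Fin 3 → ℂ) (lam : ℝ) : Prop :=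
  ∀ (W : Set (Fin 3 → ℂ)) (s : (Fin 3 → ℂ) → ℂ), IsSqrtBranch B W s →
    ∀ v : Fin 3 → ℝ, (fun i => (v i : ℂ)) ∈ W →
      eval v P = (maxwellSum d u lam s (fun i => (v i : ℂ))).re

/-- Two `n`-tuples of real vectors are the same multipole: they differ by a reordering and by
rescalings with factors of product `1`, or each of them contains the zero vector. -/
def SameMultipole {n : ℕ} (u u' : Fin n → Fin 3 → ℝ) : Prop :=
  ((∃ j, u j = 0) ∧ (∃ j, u' j = 0)) ∨
    ∃ (σ : Equiv.Perm (Fin n)) (t : Fin n → ℝ), ∏ j, t j = 1 ∧ ∀ j, u' j = t j • u (σ j)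

end

end QHarm

/-
For harmonic `H` of degree `n`, `Δ (Q^{k+1} H)` is `2 (k + 1) (2 k + 2 n + 3)` times `Q^k H`. So
`P ↦ Δ (Q P)` acts on the spaces `Q^k · Har(d - 2k)` by distinct nonzero scalars, which makes
them independent, and by induction on `d` they span. It also follows that `R ↦ Δ ((Q - c) R)` is
bijective, and the Dirichlet problem is solved by `P = N + (Q - c) R`. The solution is unique as
soon as `Q - c` divides each polynomial that vanishes on `{Q = c}`, which holds if this set has a
point other than `0`: after diagonalization of `Q`, a nonzero coordinate takes two opposite
values above an open set of the remaining ones.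

The substitution `v ↦ v A⁻¹` reduces the orthogonality to the standard form. There the integral
of a homogeneous polynomial over the sphere is a multiple of its integral against `exp (-|x|²)`.
Integrating the divergence of `H ∇G - G ∇H`, which is zero, against this weight gives the
integral of `(deg G - deg H) H G`, up to a factor `2`.

Let `n` be the number of the vectors `u_j`. Then `Q^{n + 1/2} ∇_{u_1} ⋯ ∇_{u_n} Q^{-1/2}` is a
harmonic polynomial which is congruent modulo `Q` to a nonzero multiple of the product of the
linear forms `u_j B xᵀ`. A harmonic polynomial is determined by its restriction to the cone
`{Q = 0}`. In a rational parametrization of the cone, forms of degree `n` become polynomials of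
degree at most `2 n` in one variable, and linear forms become arbitrary quadratic polynomials. A
Maxwell representation of a harmonic polynomial is therefore a factorization of its restriction into
`n` quadratic ones. If `Q` is positive definite, real forms restrict to polynomials that are
invariant under the antipodal map of the Riemann sphere. As this map has no fixed points, the
roots come in antipodal pairs, and grouping them into these pairs is the only factorization into
real quadratics.
-/

namespace QHarm

noncomputable section

section Laplacian

variable {ι κ R : Type*} [Fintype ι] [Fintype κ] [CommRing R]

/-- The quadratic form `x B xᵀ` as a polynomial; `quadPoly` is the case of three real variables. -/
def quadForm (B : Matrix ι ι R) : MvPolynomial ι R :=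
  ∑ i, ∑ j, C (B i j) * X i * X j

/-- The linear form `u xᵀ` as a polynomial. -/
def linForm (u : ι → R) : MvPolynomial ι R :=
  ∑ i, C (u i) * X i

/-- The directional derivative `∂_u = ∑ u_i ∂_i`, as a derivation of the polynomial ring. -/
def dirDeriv (u : ι → R) : Derivation R (MvPolynomial ι R) (MvPolynomial ι R) :=
  ∑ i, u i • pderiv i

theorem eval_quadForm (B : Matrix ι ι R) (v : ι → R) : eval v (quadForm B) = v ᵥ* B ⬝ᵥ v := by
  rw [← Matrix.dotProduct_mulVec]
  simp only [quadForm, map_sum, map_mul, eval_C, eval_X, dotProduct, Matrix.mulVec,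
    Finset.mul_sum, mul_left_comm, mul_assoc]

theorem eval_linForm (u v : ι → R) : eval v (linForm u) = u ⬝ᵥ v := by
  simp [linForm, dotProduct]

theorem quadForm_eq_sum_X_mul_linForm (B : Matrix ι ι R) :
    quadForm B = ∑ i, X i * linForm (B.row i) := by
  simp only [quadForm, linForm, Finset.mul_sum, Matrix.row_apply, mul_left_comm, mul_assoc]

theorem linForm_vecMul (w : κ → R) (A : Matrix κ ι R) :
    linForm (w ᵥ* A) = ∑ i, C (w i) * linForm (A.row i) := by
  simp only [linForm, Matrix.vecMul, dotProduct, map_sum, C_mul, Finset.sum_mul, Finset.mul_sum,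
    mul_assoc]
  exact Finset.sum_comm

theorem quadForm_transpose_mul (U V : Matrix κ ι R) :
    quadForm (Uᵀ * V) = ∑ i, linForm (U.row i) * linForm (V.row i) := by
  have h (j : ι) : linForm ((Uᵀ * V).row j) = ∑ i, C (U i j) * linForm (V.row i) :=
    linForm_vecMul (Uᵀ.row j) V
  rw [quadForm_eq_sum_X_mul_linForm, Finset.sum_congr rfl fun j _ => congrArg (X j * ·) (h j)]
  simp only [Finset.mul_sum]
  rw [Finset.sum_comm]
  refine Finset.sum_congr rfl fun i _ => ?_
  simp only [linForm, Finset.sum_mul, Matrix.row_apply, mul_left_comm, mul_assoc]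

theorem isHomogeneous_linForm (u : ι → R) : (linForm u).IsHomogeneous 1 :=
  IsHomogeneous.sum _ _ _ fun i _ => isHomogeneous_C_mul_X (u i) i

theorem isHomogeneous_quadForm (B : Matrix ι ι R) : (quadForm B).IsHomogeneous 2 := by
  rw [quadForm_eq_sum_X_mul_linForm]
  exact IsHomogeneous.sum _ _ _ fun i _ => (isHomogeneous_X R i).mul (isHomogeneous_linForm _)

theorem dirDeriv_apply (u : ι → R) (P : MvPolynomial ι R) :
    dirDeriv u P = ∑ i, C (u i) * pderiv i P := by
  rw [dirDeriv, ← Derivation.coeFnAddMonoidHom_apply, map_sum, Finset.sum_apply]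
  simp [smul_eq_C_mul]

theorem dirDeriv_X (u : ι → R) (i : ι) : dirDeriv u (X i) = C (u i) := by
  classical simp [dirDeriv_apply, pderiv_X, Pi.single_apply]

theorem dirDeriv_linForm (u w : ι → R) : dirDeriv u (linForm w) = C (u ⬝ᵥ w) := by
  simp [linForm, dirDeriv_X, dotProduct, mul_comm]

theorem dirDeriv_vecMul (w : κ → R) (A : Matrix κ ι R) (P : MvPolynomial ι R) :
    dirDeriv (w ᵥ* A) P = ∑ i, C (w i) * dirDeriv (A.row i) P := by
  simp only [dirDeriv_apply, Matrix.vecMul, dotProduct, map_sum, C_mul, Finset.sum_mul,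
    Finset.mul_sum, mul_assoc]
  exact Finset.sum_comm

theorem isHomogeneous_dirDeriv {P : MvPolynomial ι R} {n : ℕ} (h : P.IsHomogeneous n)
    (u : ι → R) : (dirDeriv u P).IsHomogeneous (n - 1) := by
  rw [dirDeriv_apply]
  exact IsHomogeneous.sum _ _ _ fun i _ => (h.pderiv (i := i)).C_mul (u i)

theorem dirDeriv_dirDeriv_comm (u w : ι → R) (P : MvPolynomial ι R) :
    dirDeriv u (dirDeriv w P) = dirDeriv w (dirDeriv u P) := by
  have h : ⁅dirDeriv u, dirDeriv w⁆ = 0 := derivation_ext fun i => by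
    simp [Derivation.commutator_apply, dirDeriv_X, derivation_C]
  simpa [Derivation.commutator_apply, sub_eq_zero] using congrArg (fun D => D P) h

theorem sum_pderiv_dirDeriv (U V : Matrix κ ι R) (P : MvPolynomial ι R) :
    ∑ j, pderiv j (dirDeriv ((Uᵀ * V).row j) P) =
      ∑ i, dirDeriv (U.row i) (dirDeriv (V.row i) P) := by
  have h (j : ι) : dirDeriv ((Uᵀ * V).row j) P = ∑ i, C (U i j) * dirDeriv (V.row i) P :=
    dirDeriv_vecMul (Uᵀ.row j) V P
  simp only [h, map_sum, pderiv_C_mul, dirDeriv_apply (U.row _), Matrix.row_apply]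
  exact Finset.sum_comm

variable [DecidableEq ι]

theorem linForm_single_one (i : ι) : linForm (Pi.single i (1 : R)) = X i := by
  simp [linForm, Pi.single_apply, apply_ite (C (σ := ι))]

theorem dirDeriv_single_one (i : ι) : dirDeriv (Pi.single i (1 : R)) = pderiv i := by
  simp [dirDeriv, Pi.single_apply]

/-- The operator `∑ b^{ij} ∂_i ∂_j` with `(b^{ij}) = B⁻¹`; `lapl` is the case of three real
variables. -/
def laplacian (B : Matrix ι ι R) : MvPolynomial ι R →ₗ[R] MvPolynomial ι R :=
  ∑ i, ∑ j, (B⁻¹ i j) • ((pderiv i).toLinearMap ∘ₗ (pderiv j).toLinearMap)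

/-- The space of the homogeneous polynomials of degree `n` in the kernel of `laplacian B`;
`harm` is the case of three real variables. -/
def harmonic (B : Matrix ι ι R) (n : ℕ) : Submodule R (MvPolynomial ι R) :=
  homogeneousSubmodule ι R n ⊓ LinearMap.ker (laplacian B)

theorem mem_harmonic {B : Matrix ι ι R} {n : ℕ} {P : MvPolynomial ι R} :
    P ∈ harmonic B n ↔ P.IsHomogeneous n ∧ laplacian B P = 0 :=
  Iff.rfl

theorem laplacian_apply (B : Matrix ι ι R) (P : MvPolynomial ι R) :
    laplacian B P = ∑ i, pderiv i (dirDeriv (B⁻¹.row i) P) := by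
  simp [laplacian, dirDeriv_apply, smul_eq_C_mul]

theorem isHomogeneous_laplacian (B : Matrix ι ι R) {P : MvPolynomial ι R} {n : ℕ}
    (h : P.IsHomogeneous n) : (laplacian B P).IsHomogeneous (n - 2) := by
  rw [laplacian_apply, ← Nat.sub_sub n 1 1]
  exact IsHomogeneous.sum _ _ _ fun i _ => (isHomogeneous_dirDeriv h _).pderiv

theorem laplacian_eq_zero_of_le_one (B : Matrix ι ι R) {P : MvPolynomial ι R} {n : ℕ}
    (h : P.IsHomogeneous n) (hn : n ≤ 1) : laplacian B P = 0 := by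
  rw [laplacian_apply]
  refine Finset.sum_eq_zero fun i _ => ?_
  have h0 := isHomogeneous_dirDeriv h (B⁻¹.row i)
  rw [Nat.sub_eq_zero_of_le hn, ← totalDegree_zero_iff_isHomogeneous,
    totalDegree_eq_zero_iff_eq_C] at h0
  rw [h0, pderiv_C]

theorem laplacian_dirDeriv (B : Matrix ι ι R) (u : ι → R) (P : MvPolynomial ι R) :
    laplacian B (dirDeriv u P) = dirDeriv u (laplacian B P) := by
  simp only [laplacian_apply, ← dirDeriv_single_one, map_sum, dirDeriv_dirDeriv_comm _ u]

theorem laplacian_linForm_mul {B : Matrix ι ι R} (hB : B.IsSymm) (w : ι → R)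
    (P : MvPolynomial ι R) :
    laplacian B (linForm w * P) = 2 * dirDeriv (w ᵥ* B⁻¹) P + linForm w * laplacian B P := by
  have hw (i : ι) : B⁻¹.row i ⬝ᵥ w = (w ᵥ* B⁻¹) i := by
    rw [← Matrix.mulVec_transpose, hB.inv.eq]; rfl
  have h (i : ι) : pderiv i (dirDeriv (B⁻¹.row i) (linForm w * P)) =
      C ((w ᵥ* B⁻¹) i) * pderiv i P + C (w i) * dirDeriv (B⁻¹.row i) P +
        linForm w * pderiv i (dirDeriv (B⁻¹.row i) P) := by
    simp only [← dirDeriv_single_one, Derivation.leibniz, dirDeriv_linForm, map_add, smul_eq_mul,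
      derivation_C, single_one_dotProduct, hw]
    ring
  simp only [laplacian_apply, h, Finset.sum_add_distrib, ← dirDeriv_apply, ← dirDeriv_vecMul,
    Finset.mul_sum]
  ring

theorem sum_linForm_mul_dirDeriv {B : Matrix ι ι R} (hB : B.IsSymm) (hdet : IsUnit B.det)
    (P : MvPolynomial ι R) :
    ∑ i, linForm (B.row i) * dirDeriv (B⁻¹.row i) P = ∑ i, X i * pderiv i P :=
  calc ∑ i, linForm (B.row i) * dirDeriv (B⁻¹.row i) P
      = ∑ j, X j * ∑ i, C (B.row j i) * dirDeriv (B⁻¹.row i) P := by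
        simp only [linForm, Matrix.row_apply, Finset.sum_mul, Finset.mul_sum]
        rw [Finset.sum_comm]
        refine Finset.sum_congr rfl fun j _ => Finset.sum_congr rfl fun i _ => ?_
        rw [hB.apply j i]; ring
    _ = ∑ j, X j * pderiv j P := by
        refine Finset.sum_congr rfl fun j _ => ?_
        rw [← dirDeriv_vecMul, ← dirDeriv_single_one, ← Matrix.single_one_vecMul,
          Matrix.vecMul_vecMul, Matrix.mul_nonsing_inv _ hdet, Matrix.vecMul_one]

theorem laplacian_quadForm_mul {B : Matrix ι ι R} (hB : B.IsSymm) (hdet : IsUnit B.det)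
    {P : MvPolynomial ι R} {n : ℕ} (hP : P.IsHomogeneous n) :
    laplacian B (quadForm B * P) =
      (2 * Fintype.card ι + 4 * n : ℕ) * P + quadForm B * laplacian B P := by
  have hrow (i : ι) : B.row i ᵥ* B⁻¹ = Pi.single i 1 := by
    rw [← Matrix.single_one_vecMul, Matrix.vecMul_vecMul, Matrix.mul_nonsing_inv _ hdet,
      Matrix.vecMul_one]
  have hdot (i : ι) : B⁻¹.row i ⬝ᵥ B.row i = 1 := by
    rw [← Matrix.one_apply_eq (α := R) i, ← Matrix.nonsing_inv_mul B hdet]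
    exact Finset.sum_congr rfl fun j _ => congrArg (B⁻¹ i j * ·) (hB.apply j i)
  have h (i : ι) : laplacian B (X i * (linForm (B.row i) * P)) =
      2 * P + 2 * (linForm (B.row i) * dirDeriv (B⁻¹.row i) P) + 2 * (X i * pderiv i P) +
        X i * linForm (B.row i) * laplacian B P := by
    rw [← linForm_single_one, laplacian_linForm_mul hB, laplacian_linForm_mul hB, hrow,
      dirDeriv_single_one, Matrix.single_one_vecMul, Derivation.leibniz, dirDeriv_linForm, hdot]
    simp only [smul_eq_mul, map_one]
    ring
  rw [quadForm_eq_sum_X_mul_linForm, Finset.sum_mul, map_sum]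
  simp only [mul_assoc (X _) _ P, h, Finset.sum_add_distrib, ← Finset.mul_sum, ← Finset.sum_mul,
    sum_linForm_mul_dirDeriv hB hdet, hP.sum_X_mul_pderiv]
  simp only [Finset.sum_const, Finset.card_univ, nsmul_eq_mul]
  push_cast
  ring

theorem laplacian_quadForm_pow_mul {B : Matrix ι ι R} (hB : B.IsSymm) (hdet : IsUnit B.det)
    {H : MvPolynomial ι R} {n : ℕ} (hH : H ∈ harmonic B n) (k : ℕ) :
    laplacian B (quadForm B ^ (k + 1) * H) =
      (2 * (k + 1) * (2 * k + 2 * n + Fintype.card ι) : ℕ) * (quadForm B ^ k * H) := by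
  obtain ⟨hn, h0⟩ := mem_harmonic.1 hH
  induction k with
  | zero =>
    rw [pow_succ', mul_assoc, laplacian_quadForm_mul hB hdet (by simpa using hn), pow_zero, one_mul,
      h0]
    push_cast; ring
  | succ k ih =>
    rw [pow_succ' _ (k + 1), mul_assoc,
      laplacian_quadForm_mul hB hdet (((isHomogeneous_quadForm B).pow (k + 1)).mul hn), ih]
    push_cast; ring

end Laplacian

section Substitution

variable {ι R : Type*} [Fintype ι] [CommRing R]

/-- The substitution `P(x) ↦ P(x U)`; `act` is the case of three real variables. -/
def subst (U : Matrix ι ι R) : MvPolynomial ι R →ₐ[R] MvPolynomial ι R :=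
  aeval fun j => linForm (Uᵀ.row j)

theorem subst_X (U : Matrix ι ι R) (j : ι) : subst U (X j) = linForm (Uᵀ.row j) :=
  aeval_X _ j

theorem eval_subst (U : Matrix ι ι R) (v : ι → R) (P : MvPolynomial ι R) :
    eval v (subst U P) = eval (v ᵥ* U) P := by
  have h : (aeval v).comp (subst U) = aeval (v ᵥ* U) := algHom_ext fun j => by
    rw [AlgHom.comp_apply, subst_X, aeval_X]
    exact (eval_linForm _ v).trans (dotProduct_comm _ v)
  exact DFunLike.congr_fun h P

theorem subst_linForm (U : Matrix ι ι R) (u : ι → R) :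
    subst U (linForm u) = linForm (u ᵥ* Uᵀ) := by
  rw [linForm_vecMul]
  simp [linForm, subst]

theorem subst_subst (U V : Matrix ι ι R) (P : MvPolynomial ι R) :
    subst U (subst V P) = subst (U * V) P := by
  have h : (subst U).comp (subst V) = subst (U * V) := algHom_ext fun j => by
    rw [AlgHom.comp_apply, subst_X, subst_linForm, subst_X, Matrix.transpose_mul]
    rfl
  exact DFunLike.congr_fun h P

theorem subst_one [DecidableEq ι] (P : MvPolynomial ι R) : subst (1 : Matrix ι ι R) P = P := by
  have h : subst (1 : Matrix ι ι R) = AlgHom.id R _ := algHom_ext fun j => by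
    rw [subst_X, Matrix.transpose_one, ← Matrix.single_one_vecMul, Matrix.vecMul_one,
      linForm_single_one, AlgHom.id_apply]
  exact DFunLike.congr_fun h P

theorem subst_quadForm (U B : Matrix ι ι R) : subst U (quadForm B) = quadForm (U * B * Uᵀ) := by
  have h (i : ι) : subst U (linForm (B.row i)) = linForm ((B * Uᵀ).row i) := subst_linForm U _
  simp only [quadForm_eq_sum_X_mul_linForm B, map_sum, map_mul, subst_X, h, mul_assoc U,
    ← quadForm_transpose_mul, Matrix.transpose_transpose]

theorem isHomogeneous_subst (U : Matrix ι ι R) {P : MvPolynomial ι R} {n : ℕ}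
    (h : P.IsHomogeneous n) : (subst U P).IsHomogeneous n :=
  one_mul n ▸ h.aeval _ fun _ => isHomogeneous_linForm _

theorem dirDeriv_subst (U : Matrix ι ι R) (u : ι → R) (P : MvPolynomial ι R) :
    dirDeriv u (subst U P) = subst U (dirDeriv (u ᵥ* U) P) := by
  induction P using MvPolynomial.induction_on with
  | C a => simp [subst]
  | add p q hp hq => simp only [map_add, hp, hq]
  | mul_X p k hp =>
    have hX : dirDeriv u (subst U (X k)) = C ((u ᵥ* U) k) := by
      rw [subst, aeval_X, dirDeriv_linForm]; rfl
    simp only [map_mul, Derivation.leibniz, hp, hX, smul_eq_mul, map_add, dirDeriv_X,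
      algHom_C, algebraMap_eq]

theorem laplacian_subst [DecidableEq ι] {U : Matrix ι ι R} (hU : IsUnit U.det) (B : Matrix ι ι R)
    (P : MvPolynomial ι R) :
    laplacian (U * B * Uᵀ) (subst U P) = subst U (laplacian B P) := by
  have hinv : Uᵀ * ((U * B * Uᵀ)⁻¹ * U) = B⁻¹ := by
    rw [Matrix.mul_inv_rev, Matrix.mul_inv_rev, Matrix.mul_assoc, Matrix.mul_assoc,
      Matrix.nonsing_inv_mul _ hU, Matrix.mul_one,
      Matrix.mul_nonsing_inv_cancel_left _ _ (by rwa [Matrix.det_transpose])]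
  have h (i : ι) : pderiv i (dirDeriv ((U * B * Uᵀ)⁻¹.row i) (subst U P)) =
      subst U (dirDeriv (U.row i) (dirDeriv (((U * B * Uᵀ)⁻¹ * U).row i) P)) := by
    rw [dirDeriv_subst, ← dirDeriv_single_one, dirDeriv_subst, Matrix.single_one_vecMul]
    rfl
  simp only [laplacian_apply, h, ← map_sum, ← sum_pderiv_dirDeriv, hinv]

end Substitution

section Components

variable {σ R : Type*} [CommRing R]

theorem homogeneousComponent_map {L : MvPolynomial σ R →ₗ[R] MvPolynomial σ R} {m n : ℕ}
    (hm : ∀ P, P.IsHomogeneous m → (L P).IsHomogeneous n)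
    (hne : ∀ j, j ≠ m → ∀ P, P.IsHomogeneous j → homogeneousComponent n (L P) = 0)
    (P : MvPolynomial σ R) :
    homogeneousComponent n (L P) = L (homogeneousComponent m P) := by
  have hcomp (j : ℕ) : homogeneousComponent n (L (homogeneousComponent j P)) =
      if j = m then L (homogeneousComponent m P) else 0 := by
    split_ifs with h
    · exact h ▸ homogeneousComponent_eq_self (hm _ (h ▸ homogeneousComponent_isHomogeneous _ _))
    · exact hne j h _ (homogeneousComponent_isHomogeneous _ _)
  conv_lhs => rw [← sum_homogeneousComponent P]
  simp only [map_sum, hcomp, Finset.sum_ite_eq', Finset.mem_range]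
  split_ifs with h
  · rfl
  · rw [homogeneousComponent_eq_zero _ _ (by omega), map_zero]

variable [Fintype σ]

theorem homogeneousComponent_laplacian [DecidableEq σ] (B : Matrix σ σ R) (n : ℕ)
    (P : MvPolynomial σ R) :
    homogeneousComponent n (laplacian B P) = laplacian B (homogeneousComponent (n + 2) P) := by
  refine homogeneousComponent_map (L := laplacian B) (m := n + 2)
    (fun P hP => isHomogeneous_laplacian B hP) (fun j hj P hP => ?_) P
  rcases le_or_gt j 1 with h | h
  · rw [laplacian_eq_zero_of_le_one B hP h, map_zero]
  · rw [homogeneousComponent_of_mem (isHomogeneous_laplacian B hP), if_neg (by omega)]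

theorem homogeneousComponent_quadForm_mul (B : Matrix σ σ R) (n : ℕ) (P : MvPolynomial σ R) :
    homogeneousComponent (n + 2) (quadForm B * P) = quadForm B * homogeneousComponent n P := by
  refine homogeneousComponent_map (L := LinearMap.mulLeft R (quadForm B))
    (fun P hP => add_comm 2 n ▸ (isHomogeneous_quadForm B).mul hP) (fun j hj P hP => ?_) P
  rw [LinearMap.mulLeft_apply,
    homogeneousComponent_of_mem ((isHomogeneous_quadForm B).mul hP), if_neg (by omega)]

end Components

section HarmonicSummand

variable {ι R : Type*} [Fintype ι] [DecidableEq ι] [CommRing R] {B : Matrix ι ι R} {d k : ℕ}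
  {P : MvPolynomial ι R}

/-- The space `Q^k · Har(d - 2k)`, meaningful for `2k ≤ d` only; `summand` is the case of three
real variables. -/
def harmonicSummand (B : Matrix ι ι R) (d k : ℕ) : Submodule R (MvPolynomial ι R) :=
  (harmonic B (d - 2 * k)).map (LinearMap.mulLeft R (quadForm B ^ k))

theorem mem_harmonicSummand :
    P ∈ harmonicSummand B d k ↔ ∃ H ∈ harmonic B (d - 2 * k), quadForm B ^ k * H = P :=
  Submodule.mem_map

theorem isHomogeneous_of_mem_harmonicSummand (hk : 2 * k ≤ d) (hP : P ∈ harmonicSummand B d k) :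
    P.IsHomogeneous d := by
  obtain ⟨H, hH, rfl⟩ := mem_harmonicSummand.1 hP
  have h := ((isHomogeneous_quadForm B).pow k).mul (mem_harmonic.1 hH).1
  rwa [Nat.add_sub_of_le hk] at h

theorem mem_harmonicSummand_zero : P ∈ harmonicSummand B d 0 ↔ P ∈ harmonic B d := by
  simp [mem_harmonicSummand]

theorem quadForm_mul_mem_harmonicSummand (hP : P ∈ harmonicSummand B d k) :
    quadForm B * P ∈ harmonicSummand B (d + 2) (k + 1) := by
  obtain ⟨H, hH, rfl⟩ := mem_harmonicSummand.1 hP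
  exact mem_harmonicSummand.2 ⟨H, by rwa [show d + 2 - 2 * (k + 1) = d - 2 * k by omega], by ring⟩

/-- The eigenvalue of `P ↦ Δ (Q P)` on `Q^k · Har(d - 2k)` in `N` variables. -/
def laplacianEigenvalue (N d k : ℕ) : ℕ :=
  2 * (k + 1) * (2 * k + 2 * (d - 2 * k) + N)

theorem laplacianEigenvalue_ne_zero (N d k : ℕ) [NeZero N] : laplacianEigenvalue N d k ≠ 0 :=
  mul_ne_zero (by simp) (by have := NeZero.ne N; omega)

theorem laplacianEigenvalue_strictMonoOn (N d : ℕ) [NeZero N] :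
    StrictMonoOn (laplacianEigenvalue N d) {k | 2 * k ≤ d} := by
  intro a _ b hb hab
  obtain ⟨e, rfl⟩ := Nat.exists_eq_add_of_le (Set.mem_ofPred.1 hb)
  obtain ⟨f, rfl⟩ := Nat.exists_eq_add_of_lt hab
  have hN := NeZero.pos N
  simp only [laplacianEigenvalue]
  rw [show 2 * (a + f + 1) + e - 2 * a = 2 * (f + 1) + e by omega, Nat.add_sub_cancel_left]
  nlinarith

theorem laplacian_quadForm_mul_of_mem_harmonicSummand (hB : B.IsSymm) (hdet : IsUnit B.det)
    (hP : P ∈ harmonicSummand B d k) :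
    laplacian B (quadForm B * P) = (laplacianEigenvalue (Fintype.card ι) d k : R) • P := by
  obtain ⟨H, hH, rfl⟩ := mem_harmonicSummand.1 hP
  rw [← mul_assoc, ← pow_succ', laplacian_quadForm_pow_mul hB hdet hH, smul_eq_C_mul, map_natCast,
    laplacianEigenvalue]

/-- The operator `P ↦ Δ ((Q - c) P)`, whose bijectivity amounts to the solvability of the Dirichlet
problem on `{Q = c}`. -/
def dirichletOperator (B : Matrix ι ι R) (c : R) : MvPolynomial ι R →ₗ[R] MvPolynomial ι R :=
  laplacian B ∘ₗ LinearMap.mulLeft R (quadForm B - C c)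

theorem dirichletOperator_apply (B : Matrix ι ι R) (c : R) (P : MvPolynomial ι R) :
    dirichletOperator B c P = laplacian B (quadForm B * P) - c • laplacian B P := by
  rw [dirichletOperator, LinearMap.comp_apply, LinearMap.mulLeft_apply, sub_mul, map_sub,
    ← smul_eq_C_mul, map_smul]
end HarmonicSummand

section Decomposition

variable {ι K : Type*} [Fintype ι] [DecidableEq ι] [Nonempty ι] [Field K] [CharZero K]
  {B : Matrix ι ι K} {d k : ℕ} {P : MvPolynomial ι K}

theorem iSupIndep_harmonicSummand (hB : B.IsSymm) (hdet : IsUnit B.det) (d : ℕ) :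
    iSupIndep fun k : Fin (d / 2 + 1) => harmonicSummand B d k := by
  have hinj : Function.Injective fun k : Fin (d / 2 + 1) =>
      (laplacianEigenvalue (Fintype.card ι) d k : K) := fun a b hab =>
    Fin.ext <| (laplacianEigenvalue_strictMonoOn _ d).injOn (Set.mem_ofPred.2 (by omega))
      (Set.mem_ofPred.2 (by omega)) (Nat.cast_injective hab)
  refine ((Module.End.eigenspaces_iSupIndep
    (laplacian B ∘ₗ LinearMap.mulLeft K (quadForm B))).comp hinj).mono fun k P hP => ?_
  rw [Function.comp_apply, Module.End.mem_eigenspace_iff]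
  exact laplacian_quadForm_mul_of_mem_harmonicSummand hB hdet hP

theorem iSup_harmonicSummand_le_map (hB : B.IsSymm) (hdet : IsUnit B.det) (d : ℕ) :
    ⨆ k : Fin (d / 2 + 1), harmonicSummand B d k ≤
      (⨆ k : Fin (d / 2 + 1), harmonicSummand B d k).map
        (laplacian B ∘ₗ LinearMap.mulLeft K (quadForm B)) := by
  refine iSup_le fun k P hP => ?_
  have hne : (laplacianEigenvalue (Fintype.card ι) d k : K) ≠ 0 :=
    Nat.cast_ne_zero.2 (laplacianEigenvalue_ne_zero _ d k)
  refine ⟨(laplacianEigenvalue (Fintype.card ι) d k : K)⁻¹ • P,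
    Submodule.smul_mem _ _ (Submodule.mem_iSup_of_mem k hP), ?_⟩
  rw [map_smul, LinearMap.comp_apply, LinearMap.mulLeft_apply,
    laplacian_quadForm_mul_of_mem_harmonicSummand hB hdet hP, inv_smul_smul₀ hne]

theorem iSup_harmonicSummand (hB : B.IsSymm) (hdet : IsUnit B.det) (d : ℕ) :
    ⨆ k : Fin (d / 2 + 1), harmonicSummand B d k = homogeneousSubmodule ι K d := by
  refine le_antisymm
    (iSup_le fun k P hP => isHomogeneous_of_mem_harmonicSummand (by omega) hP) ?_
  induction d using Nat.twoStepInduction with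
  | zero | one =>
    exact fun P hP => Submodule.mem_iSup_of_mem 0
      (mem_harmonicSummand_zero.2 ⟨hP, laplacian_eq_zero_of_le_one B hP (by norm_num)⟩)
  | more d ih _ =>
    intro P hP
    obtain ⟨R, hR, hRP : laplacian B (quadForm B * R) = laplacian B P⟩ :=
      iSup_harmonicSummand_le_map hB hdet d (ih (isHomogeneous_laplacian B hP))
    have hQR : quadForm B * R ∈ ⨆ k : Fin ((d + 2) / 2 + 1), harmonicSummand B (d + 2) k := by
      suffices h : ⨆ k : Fin (d / 2 + 1), harmonicSummand B d k ≤
          (⨆ k : Fin ((d + 2) / 2 + 1), harmonicSummand B (d + 2) k).comap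
            (LinearMap.mulLeft K (quadForm B)) from h hR
      refine iSup_le fun k S hS => ?_
      exact Submodule.mem_iSup_of_mem (⟨k + 1, by omega⟩ : Fin ((d + 2) / 2 + 1))
        (quadForm_mul_mem_harmonicSummand hS)
    have hsub : P - quadForm B * R ∈ ⨆ k : Fin ((d + 2) / 2 + 1), harmonicSummand B (d + 2) k := by
      have hQRhom : (quadForm B * R).IsHomogeneous (d + 2) :=
        (iSup_le fun k _ hS => isHomogeneous_of_mem_harmonicSummand (by omega) hS :
          _ ≤ homogeneousSubmodule ι K (d + 2)) hQR
      exact Submodule.mem_iSup_of_mem 0 (mem_harmonicSummand_zero.2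
        (mem_harmonic.2 ⟨IsHomogeneous.sub hP hQRhom, by rw [map_sub, hRP, sub_self]⟩))
    exact sub_add_cancel P (quadForm B * R) ▸ Submodule.add_mem _ hsub hQR

theorem exists_harmonic_decomposition (hB : B.IsSymm) (hdet : IsUnit B.det)
    (hP : P.IsHomogeneous d) :
    ∃ H : ℕ → MvPolynomial ι K, (∀ k, 2 * k ≤ d → H k ∈ harmonic B (d - 2 * k)) ∧
      P = ∑ k ∈ Finset.range (d / 2 + 1), quadForm B ^ k * H k := by
  rw [← mem_homogeneousSubmodule, ← iSup_harmonicSummand hB hdet,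
    Submodule.mem_iSup_iff_exists_finsupp] at hP
  obtain ⟨f, hf, rfl⟩ := hP
  choose H hH hfH using fun k => mem_harmonicSummand.1 (hf k)
  refine ⟨fun k => if hk : k < d / 2 + 1 then H ⟨k, hk⟩ else 0, fun k hk => ?_, ?_⟩
  · simpa only [dif_pos (by omega : k < d / 2 + 1)] using hH ⟨k, by omega⟩
  · rw [Finsupp.sum_fintype _ _ fun _ => rfl, Finset.sum_range]
    refine Finset.sum_congr rfl fun k _ => ?_
    simp only [dif_pos k.isLt, hfH k]

theorem eq_zero_of_laplacian_quadForm_mul_eq_zero (hB : B.IsSymm) (hdet : IsUnit B.det)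
    (hP : P.IsHomogeneous d) (h0 : laplacian B (quadForm B * P) = 0) : P = 0 := by
  have hdisj := Module.End.eigenspaces_iSupIndep
    (laplacian B ∘ₗ LinearMap.mulLeft K (quadForm B)) 0
  refine Submodule.disjoint_def.1 hdisj P ?_ ?_
  · rwa [Module.End.mem_eigenspace_iff, zero_smul]
  · rw [← mem_homogeneousSubmodule, ← iSup_harmonicSummand hB hdet] at hP
    suffices h : ⨆ k : Fin (d / 2 + 1), harmonicSummand B d k ≤ _ from h hP
    refine iSup_le fun k S hS => ?_
    refine Submodule.mem_iSup_of_mem (laplacianEigenvalue (Fintype.card ι) d k : K)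
      (Submodule.mem_iSup_of_mem (Nat.cast_ne_zero.2 (laplacianEigenvalue_ne_zero _ d k)) ?_)
    exact Module.End.mem_eigenspace_iff.2
      (laplacian_quadForm_mul_of_mem_harmonicSummand hB hdet hS)

theorem quadForm_ne_zero (hB : B.IsSymm) (hdet : IsUnit B.det) : quadForm B ≠ 0 := fun h =>
  one_ne_zero (eq_zero_of_laplacian_quadForm_mul_eq_zero hB hdet (isHomogeneous_one ι K)
    (by rw [h, zero_mul, map_zero]))

theorem eq_of_sum_quadForm_pow_mul_eq (hB : B.IsSymm) (hdet : IsUnit B.det)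
    {H G : ℕ → MvPolynomial ι K} (hH : ∀ k, 2 * k ≤ d → H k ∈ harmonic B (d - 2 * k))
    (hG : ∀ k, 2 * k ≤ d → G k ∈ harmonic B (d - 2 * k))
    (h : ∑ k ∈ Finset.range (d / 2 + 1), quadForm B ^ k * H k =
      ∑ k ∈ Finset.range (d / 2 + 1), quadForm B ^ k * G k) (hk : 2 * k ≤ d) :
    H k = G k := by
  simp only [Finset.sum_range] at h
  refine mul_left_cancel₀ (pow_ne_zero k (quadForm_ne_zero hB hdet))
    ((iSupIndep_iff_finsetSum_eq_imp_eq _).1 (iSupIndep_harmonicSummand hB hdet d) Finset.univ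
      (fun k => quadForm B ^ (k : ℕ) * H k) (fun k => quadForm B ^ (k : ℕ) * G k)
      (fun i _ => ?_) h ⟨k, by omega⟩ (Finset.mem_univ _))
  exact ⟨mem_harmonicSummand.2 ⟨_, hH i (by omega), rfl⟩,
    mem_harmonicSummand.2 ⟨_, hG i (by omega), rfl⟩⟩

theorem quadForm_pow_mul_mem_range_dirichletOperator (hB : B.IsSymm) (hdet : IsUnit B.det) (c : K)
    {H : MvPolynomial ι K} (hH : H ∈ harmonic B d) (k : ℕ) :
    quadForm B ^ k * H ∈ LinearMap.range (dirichletOperator B c) := by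
  have hne (k : ℕ) : (2 * (k + 1) * (2 * k + 2 * d + Fintype.card ι) : ℕ) ≠ (0 : K) :=
    Nat.cast_ne_zero.2 (mul_ne_zero (by simp) (by have := Fintype.card_ne_zero (α := ι); omega))
  have hlap (k : ℕ) : laplacian B (quadForm B ^ (k + 1) * H) =
      ((2 * (k + 1) * (2 * k + 2 * d + Fintype.card ι) : ℕ) : K) • (quadForm B ^ k * H) := by
    rw [laplacian_quadForm_pow_mul hB hdet hH, smul_eq_C_mul, map_natCast]
  have hstep (k : ℕ)
      (h : laplacian B (quadForm B ^ k * H) ∈ LinearMap.range (dirichletOperator B c)) :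
      quadForm B ^ k * H ∈ LinearMap.range (dirichletOperator B c) := by
    have hsum := Submodule.add_mem _
      (LinearMap.mem_range_self (dirichletOperator B c) (quadForm B ^ k * H))
      (Submodule.smul_mem _ c h)
    rw [dirichletOperator_apply, ← mul_assoc, ← pow_succ', sub_add_cancel, hlap] at hsum
    exact (Submodule.smul_mem_iff _ (hne k)).1 hsum
  induction k with
  | zero => exact hstep 0 (by simp [(mem_harmonic.1 hH).2])
  | succ k ih => exact hstep (k + 1) (hlap k ▸ Submodule.smul_mem _ _ ih)

theorem dirichletOperator_surjective (hB : B.IsSymm) (hdet : IsUnit B.det) (c : K) :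
    Function.Surjective (dirichletOperator B c) := by
  intro M
  rw [← LinearMap.mem_range, ← sum_homogeneousComponent M]
  refine Submodule.sum_mem _ fun i _ => ?_
  obtain ⟨H, hH, hMH⟩ :=
    exists_harmonic_decomposition hB hdet (homogeneousComponent_isHomogeneous i M)
  rw [hMH]
  refine Submodule.sum_mem _ fun k hk => ?_
  exact quadForm_pow_mul_mem_range_dirichletOperator hB hdet c
    (hH k (by have := Finset.mem_range.1 hk; omega)) k

theorem dirichletOperator_injective (hB : B.IsSymm) (hdet : IsUnit B.det) (c : K) :
    Function.Injective (dirichletOperator B c) := by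
  rw [← LinearMap.ker_eq_bot, LinearMap.ker_eq_bot']
  intro R hR
  rw [dirichletOperator_apply, sub_eq_zero] at hR
  have hstep (i : ℕ) : laplacian B (quadForm B * homogeneousComponent i R) =
      c • laplacian B (homogeneousComponent (i + 2) R) := by
    rw [← homogeneousComponent_quadForm_mul, ← homogeneousComponent_laplacian, hR, map_smul,
      homogeneousComponent_laplacian]
  have hzero (m : ℕ) : ∀ i, R.totalDegree < i + 2 * m → homogeneousComponent i R = 0 := by
    induction m with
    | zero => exact fun i hi => homogeneousComponent_eq_zero i R hi
    | succ m ih =>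
      intro i hi
      refine eq_zero_of_laplacian_quadForm_mul_eq_zero hB hdet
        (homogeneousComponent_isHomogeneous i R) ?_
      rw [hstep, ih (i + 2) (by omega), map_zero, smul_zero]
  rw [← sum_homogeneousComponent R]
  exact Finset.sum_eq_zero fun i _ => hzero (R.totalDegree + 1) i (by omega)

theorem eq_zero_of_quadForm_sub_dvd (hB : B.IsSymm) (hdet : IsUnit B.det) {c : K}
    (hP : laplacian B P = 0) (hdvd : quadForm B - C c ∣ P) : P = 0 := by
  obtain ⟨R, rfl⟩ := hdvd
  rw [dirichletOperator_injective hB hdet c (hP.trans (map_zero _).symm), mul_zero]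

theorem exists_laplacian_eq_and_eval_eq (hB : B.IsSymm) (hdet : IsUnit B.det) (c : K)
    (M N : MvPolynomial ι K) :
    ∃ P, laplacian B P = M ∧ ∀ v, eval v (quadForm B) = c → eval v P = eval v N := by
  obtain ⟨R, hR⟩ := dirichletOperator_surjective hB hdet c (M - laplacian B N)
  refine ⟨N + (quadForm B - C c) * R, by
    rw [map_add, ← LinearMap.mulLeft_apply (R := K), ← LinearMap.comp_apply, ← dirichletOperator,
      hR, add_sub_cancel], fun v hv => ?_⟩
  simp [hv]

end Decomposition

section Quadrics

theorem eq_zero_of_eval_eq_zero_of_isOpen {ι : Type*} [Finite ι] {P : MvPolynomial ι ℝ}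
    {U : Set (ι → ℝ)} (hU : IsOpen U) (hne : U.Nonempty) (hP : ∀ x ∈ U, eval x P = 0) : P = 0 := by
  have := Fintype.ofFinite ι
  obtain ⟨x, hx⟩ := hne
  obtain ⟨ε, hε, hball⟩ := Metric.isOpen_iff.1 hU x hx
  rw [ball_pi x hε] at hball
  refine funext_set (fun i => Metric.ball (x i) ε) (fun i => ?_) fun y hy => ?_
  · rw [Real.ball_eq_Ioo]
    exact Set.Ioo_infinite (by linarith)
  · rw [hP y (hball hy), map_zero]

variable {n : ℕ}

section Field

variable {K : Type*} [Field K] [NeZero (2 : K)] {S : Set (Fin n → K)}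

/- On the remainder `r₁ x₀ + r₀` of the division by `x₀² - δ`, the two square roots of `δ` impose
two independent conditions wherever `δ` is a nonzero square. -/
theorem dvd_of_finSuccEquiv_eq_X_sq_sub_C {G P : MvPolynomial (Fin (n + 1)) K}
    {δ : MvPolynomial (Fin n) K} (hG : finSuccEquiv K n G = Polynomial.X ^ 2 - Polynomial.C δ)
    (hS : ∀ f : MvPolynomial (Fin n) K, (∀ x ∈ S, eval x f = 0) → f = 0)
    (hδ : ∀ x ∈ S, ∃ y ≠ 0, y ^ 2 = eval x δ)
    (hP : ∀ x ∈ S, ∀ y, y ^ 2 = eval x δ → eval (Fin.cons y x : Fin (n + 1) → K) P = 0) :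
    G ∣ P := by
  set D : Polynomial (MvPolynomial (Fin n) K) := Polynomial.X ^ 2 - Polynomial.C δ with hD
  have hmonic : D.Monic := Polynomial.monic_X_pow_sub_C δ two_ne_zero
  have hDdeg : D.natDegree = 2 := Polynomial.natDegree_X_pow_sub_C
  set r := finSuccEquiv K n P %ₘ D
  have hdiv : r + D * (finSuccEquiv K n P /ₘ D) = finSuccEquiv K n P :=
    Polynomial.modByMonic_add_div _ D
  have hrdeg : r.natDegree < 2 := hDdeg ▸ Polynomial.natDegree_modByMonic_lt _ hmonic fun h => by
    simp [h] at hDdeg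
  have hr : r = Polynomial.C (r.coeff 1) * Polynomial.X + Polynomial.C (r.coeff 0) :=
    Polynomial.eq_X_add_C_of_natDegree_le_one (by omega)
  have hroot {x : Fin n → K} (hx : x ∈ S) {y : K} (hy : y ^ 2 = eval x δ) :
      eval x (r.coeff 1) * y + eval x (r.coeff 0) = 0 := by
    have hv := hP x hx y hy
    rw [eval_eq_eval_mv_eval', ← hdiv, hr] at hv
    simpa [hD, hy] using hv
  have hcoeff (x : Fin n → K) (hx : x ∈ S) :
      eval x (r.coeff 0) = 0 ∧ eval x (r.coeff 1) = 0 := by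
    obtain ⟨y, hy0, hy⟩ := hδ x hx
    have hpos := hroot hx hy
    have hneg := hroot hx ((neg_sq y).trans hy)
    have h0 : eval x (r.coeff 0) = 0 :=
      mul_left_cancel₀ (two_ne_zero (α := K)) (by linear_combination hpos + hneg)
    rw [h0, add_zero] at hpos
    exact ⟨h0, (mul_eq_zero.1 hpos).resolve_right hy0⟩
  have hr0 : r = 0 := by
    rw [hr, hS _ fun x hx => (hcoeff x hx).1, hS _ fun x hx => (hcoeff x hx).2]
    simp
  rw [← map_dvd_iff (finSuccEquiv K n), hG, ← hdiv, hr0, zero_add]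
  exact dvd_mul_right _ _

theorem quadForm_diagonal {ι R : Type*} [Fintype ι] [DecidableEq ι] [CommRing R] (d : ι → R) :
    quadForm (Matrix.diagonal d) = ∑ i, C (d i) * X i ^ 2 := by
  simp only [quadForm, Matrix.diagonal_apply, apply_ite (C (σ := ι)), map_zero, ite_mul, zero_mul,
    Finset.sum_ite_eq, Finset.mem_univ, if_true, sq, mul_assoc]

theorem eval_cons_quadForm_diagonal {R : Type*} [CommRing R] (d : Fin (n + 1) → R) (y : R)
    (x : Fin n → R) : eval (Fin.cons y x : Fin (n + 1) → R) (quadForm (Matrix.diagonal d)) =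
      d 0 * y ^ 2 + ∑ i, d i.succ * x i ^ 2 := by
  simp [quadForm_diagonal, Fin.sum_univ_succ]

theorem quadForm_diagonal_sub_dvd {d : Fin (n + 1) → K} (hd : d 0 ≠ 0) {c : K}
    (hS : ∀ f : MvPolynomial (Fin n) K, (∀ x ∈ S, eval x f = 0) → f = 0)
    (hδ : ∀ x ∈ S, ∃ y ≠ 0,
      eval (Fin.cons y x : Fin (n + 1) → K) (quadForm (Matrix.diagonal d)) = c)
    {P : MvPolynomial (Fin (n + 1)) K}
    (hP : ∀ x ∈ S, ∀ y, eval (Fin.cons y x : Fin (n + 1) → K) (quadForm (Matrix.diagonal d)) = c →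
      eval (Fin.cons y x : Fin (n + 1) → K) P = 0) :
    quadForm (Matrix.diagonal d) - C c ∣ P := by
  set δ : MvPolynomial (Fin n) K := C (d 0)⁻¹ * (C c - ∑ i, C (d i.succ) * X i ^ 2) with hδ_def
  have hsq (x : Fin n → K) (y : K) : y ^ 2 = eval x δ ↔
      eval (Fin.cons y x : Fin (n + 1) → K) (quadForm (Matrix.diagonal d)) = c := by
    simp only [eval_cons_quadForm_diagonal, hδ_def, map_mul, map_sub, map_sum, map_pow, eval_C,
      eval_X, eq_inv_mul_iff_mul_eq₀ hd, eq_sub_iff_add_eq]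
  have hG : finSuccEquiv K n (C (d 0)⁻¹ * (quadForm (Matrix.diagonal d) - C c)) =
      Polynomial.X ^ 2 - Polynomial.C δ := by
    have hC (a : K) : finSuccEquiv K n (C a) = Polynomial.C (C a) := by
      simp [finSuccEquiv_apply]
    have hone : (Polynomial.C (C (d 0)⁻¹) * Polynomial.C (C (d 0)) :
        Polynomial (MvPolynomial (Fin n) K)) = 1 := by
      rw [← map_mul, ← map_mul, inv_mul_cancel₀ hd, map_one, map_one]
    simp only [quadForm_diagonal, Fin.sum_univ_succ, map_mul, map_sub, map_add, map_sum, map_pow,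
      hC, finSuccEquiv_X_zero, finSuccEquiv_X_succ, hδ_def]
    linear_combination Polynomial.X ^ 2 * hone
  refine (dvd_mul_left _ _).trans (dvd_of_finSuccEquiv_eq_X_sq_sub_C hG hS (fun x hx => ?_)
    fun x hx y hy => hP x hx y ((hsq x y).1 hy))
  obtain ⟨y, hy0, hy⟩ := hδ x hx
  exact ⟨y, hy0, (hsq x y).2 hy⟩

end Field

theorem quadForm_diagonal_sub_dvd_of_eval_eq_zero {d w : Fin (n + 1) → ℝ} (hd : d 0 ≠ 0)
    (hw : w 0 ≠ 0) {c : ℝ} (hc : eval w (quadForm (Matrix.diagonal d)) = c)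
    {P : MvPolynomial (Fin (n + 1)) ℝ}
    (hP : ∀ v, eval v (quadForm (Matrix.diagonal d)) = c → eval v P = 0) :
    quadForm (Matrix.diagonal d) - C c ∣ P := by
  set q : (Fin n → ℝ) → ℝ := fun x => (d 0)⁻¹ * (c - ∑ i, d i.succ * x i ^ 2) with hq
  have hopen : IsOpen {x | 0 < q x} := isOpen_lt continuous_const (by fun_prop)
  have hne : {x | 0 < q x}.Nonempty := by
    refine ⟨Fin.tail w, ?_⟩
    have h : d 0 * w 0 ^ 2 + ∑ i, d i.succ * Fin.tail w i ^ 2 = c := by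
      rw [← hc, ← eval_cons_quadForm_diagonal, Fin.cons_self_tail]
    have hsq : q (Fin.tail w) = w 0 ^ 2 := by
      rw [hq, ← h]
      simp only [add_sub_cancel_right, inv_mul_cancel_left₀ hd]
    rw [Set.mem_ofPred, hsq]
    positivity
  refine quadForm_diagonal_sub_dvd hd
    (fun f hf => eq_zero_of_eval_eq_zero_of_isOpen hopen hne hf)
    (fun x hx => ⟨√(q x), (Real.sqrt_pos.2 hx).ne', ?_⟩) fun x _ y hy => hP _ hy
  rw [eval_cons_quadForm_diagonal, Real.sq_sqrt (Set.mem_ofPred.1 hx).le, hq,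
    mul_inv_cancel_left₀ hd, sub_add_cancel]

theorem exists_mul_mul_transpose_eq_diagonal {ι : Type*} [Fintype ι] [DecidableEq ι]
    {B : Matrix ι ι ℝ} (hB : B.IsSymm) :
    ∃ (U : Matrix ι ι ℝ) (d : ι → ℝ), IsUnit U.det ∧ U * B * Uᵀ = Matrix.diagonal d := by
  have hH : B.IsHermitian := (Matrix.conjTranspose_eq_transpose_of_trivial B).trans hB
  refine ⟨star hH.eigenvectorUnitary, hH.eigenvalues, ?_, ?_⟩
  · exact Matrix.UnitaryGroup.det_isUnit (star hH.eigenvectorUnitary)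
  · have h := hH.conjStarAlgAut_star_eigenvectorUnitary
    rw [Unitary.conjStarAlgAut_apply] at h
    rw [← Matrix.conjTranspose_eq_transpose_of_trivial]
    exact h

theorem exists_mul_mul_transpose_eq_diagonal_of_ne_zero {B : Matrix (Fin (n + 1)) (Fin (n + 1)) ℝ}
    (hB : B.IsSymm) {v : Fin (n + 1) → ℝ} (hv : v ≠ 0) :
    ∃ (U : Matrix (Fin (n + 1)) (Fin (n + 1)) ℝ) (d w : Fin (n + 1) → ℝ), IsUnit U.det ∧
      U * B * Uᵀ = Matrix.diagonal d ∧ w ᵥ* U = v ∧ w 0 ≠ 0 := by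
  obtain ⟨U, d, hU, hd⟩ := exists_mul_mul_transpose_eq_diagonal hB
  have hvU : v ᵥ* U⁻¹ ᵥ* U = v := by
    rw [Matrix.vecMul_vecMul, Matrix.nonsing_inv_mul _ hU, Matrix.vecMul_one]
  obtain ⟨i, hi⟩ : ∃ i, (v ᵥ* U⁻¹) i ≠ 0 := by
    by_contra! h
    exact hv (by rw [← hvU, show v ᵥ* U⁻¹ = 0 from funext h, Matrix.zero_vecMul])
  let σ : Equiv.Perm (Fin (n + 1)) := Equiv.swap 0 i
  refine ⟨U.submatrix σ id, d ∘ σ, (v ᵥ* U⁻¹) ∘ σ, ?_, ?_, ?_, by simpa [σ] using hi⟩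
  · rw [Matrix.det_permute]
    exact ((Equiv.Perm.sign σ).isUnit.map (Int.castRingHom ℝ)).mul hU
  · rw [← Matrix.submatrix_diagonal_equiv, ← hd]
    ext a b
    simp [Matrix.mul_apply]
  · ext j
    exact (Equiv.sum_comp σ fun k => (v ᵥ* U⁻¹) k * U k j).trans (congrFun hvU j)

theorem quadForm_sub_dvd_of_eval_eq_zero {B : Matrix (Fin (n + 1)) (Fin (n + 1)) ℝ}
    (hB : B.IsSymm) (hdet : IsUnit B.det) {c : ℝ} (hc : ∃ v ≠ 0, eval v (quadForm B) = c)
    {P : MvPolynomial (Fin (n + 1)) ℝ} (hP : ∀ v, eval v (quadForm B) = c → eval v P = 0) :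
    quadForm B - C c ∣ P := by
  obtain ⟨v, hv, hvc⟩ := hc
  obtain ⟨U, d, w, hU, hd, rfl, hw⟩ := exists_mul_mul_transpose_eq_diagonal_of_ne_zero hB hv
  have hd0 : d 0 ≠ 0 := fun h => by
    have hprod : IsUnit (∏ i, d i) := by
      rw [← Matrix.det_diagonal, ← hd, Matrix.det_mul, Matrix.det_mul, Matrix.det_transpose]
      exact (hU.mul hdet).mul hU
    exact hprod.ne_zero (Finset.prod_eq_zero (Finset.mem_univ 0) h)
  have hev (x : Fin (n + 1) → ℝ) :
      eval x (quadForm (Matrix.diagonal d)) = eval (x ᵥ* U) (quadForm B) := by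
    rw [← hd, ← subst_quadForm, eval_subst]
  have hdvd := quadForm_diagonal_sub_dvd_of_eval_eq_zero (P := subst U P) hd0 hw
    ((hev w).trans hvc) fun x hx => by rw [eval_subst, hP _ ((hev x).symm.trans hx)]
  have hsubst : subst U (quadForm B - C c) ∣ subst U P := by
    rwa [map_sub, subst_quadForm, hd, subst, algHom_C]
  simpa only [subst_subst, Matrix.nonsing_inv_mul _ hU, subst_one] using
    map_dvd (subst U⁻¹) hsubst

theorem eq_of_laplacian_eq_of_eval_eq {B : Matrix (Fin (n + 1)) (Fin (n + 1)) ℝ}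
    (hB : B.IsSymm) (hdet : IsUnit B.det) {c : ℝ} (hc : ∃ v ≠ 0, eval v (quadForm B) = c)
    {P R : MvPolynomial (Fin (n + 1)) ℝ} (hlap : laplacian B P = laplacian B R)
    (hPR : ∀ v, eval v (quadForm B) = c → eval v P = eval v R) : P = R := by
  refine sub_eq_zero.1 (eq_zero_of_quadForm_sub_dvd hB hdet ?_
    (quadForm_sub_dvd_of_eval_eq_zero hB hdet hc fun v hv => ?_))
  · rw [map_sub, hlap, sub_self]
  · rw [map_sub, hPR v hv, sub_self]

end Quadrics

section BaseChange

variable {ι R S : Type*} [CommRing R] [CommRing S] (f : R →+* S)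

theorem eval_comp_map (v : ι → R) (P : MvPolynomial ι R) :
    eval (f ∘ v) (map f P) = f (eval v P) := by
  rw [eval_map, eval₂_comp f v P]

variable [Fintype ι]

theorem map_quadForm (B : Matrix ι ι R) : map f (quadForm B) = quadForm (B.map f) := by
  simp only [quadForm, map_sum, map_mul, map_C, map_X, Matrix.map_apply]

theorem map_linForm (u : ι → R) : map f (linForm u) = linForm (f ∘ u) := by
  simp only [linForm, map_sum, map_mul, map_C, map_X, Function.comp_apply]

theorem map_dirDeriv (u : ι → R) (P : MvPolynomial ι R) :
    map f (dirDeriv u P) = dirDeriv (f ∘ u) (map f P) := by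
  simp only [dirDeriv_apply, map_sum, map_mul, map_C, pderiv_map, Function.comp_apply]

variable [DecidableEq ι] {B : Matrix ι ι R}

theorem isUnit_det_map (hdet : IsUnit B.det) : IsUnit (B.map f).det := by
  rw [← RingHom.mapMatrix_apply, ← RingHom.map_det]
  exact hdet.map f

theorem map_laplacian (hdet : IsUnit B.det) (P : MvPolynomial ι R) :
    map f (laplacian B P) = laplacian (B.map f) (map f P) := by
  have hinv : (B.map f)⁻¹ = B⁻¹.map f := Matrix.inv_eq_right_inv (by
    rw [← Matrix.map_mul, Matrix.mul_nonsing_inv _ hdet, Matrix.map_one _ (map_zero f) (map_one f)])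
  simp only [laplacian_apply, map_sum, ← pderiv_map, map_dirDeriv, hinv]
  rfl

theorem map_mem_harmonic (hdet : IsUnit B.det) {P : MvPolynomial ι R} {n : ℕ}
    (hP : P ∈ harmonic B n) : map f P ∈ harmonic (B.map f) n :=
  mem_harmonic.2 ⟨hP.1.map f, by rw [← map_laplacian f hdet, (mem_harmonic.1 hP).2, map_zero]⟩

end BaseChange

section Maxwell

variable {ι R : Type*} [Fintype ι] [CommRing R]

theorem dirDeriv_quadForm {B : Matrix ι ι R} (hB : B.IsSymm) (u : ι → R) :
    dirDeriv u (quadForm B) = 2 * linForm (u ᵥ* B) := by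
  have hX (w : ι → R) : ∑ i, X i * C (w i) = linForm w :=
    Finset.sum_congr rfl fun i _ => mul_comm _ _
  have hrow (i : ι) : u ⬝ᵥ B.row i = (u ᵥ* B) i := by
    rw [dotProduct_comm, ← Matrix.mulVec_transpose, hB.eq]; rfl
  simp only [quadForm_eq_sum_X_mul_linForm, map_sum, Derivation.leibniz, dirDeriv_linForm,
    dirDeriv_X, smul_eq_mul, Finset.sum_add_distrib, hrow, hX]
  rw [two_mul, linForm_vecMul]
  simp only [mul_comm]

/-- The polynomial `Q^{n + N/2 - 1} ∇_{u_1} ⋯ ∇_{u_n} Q^{1 - N/2}` for the list `[u_1, …, u_n]` of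
vectors of a space of dimension `N`, by recursion on the list. -/
def maxwellPoly (B : Matrix ι ι R) : List (ι → R) → MvPolynomial ι R
  | [] => 1
  | u :: us => quadForm B * dirDeriv u (maxwellPoly B us) -
      C (2 * us.length + Fintype.card ι - 2 : R) * (linForm (u ᵥ* B) * maxwellPoly B us)

theorem isHomogeneous_maxwellPoly (B : Matrix ι ι R) (us : List (ι → R)) :
    (maxwellPoly B us).IsHomogeneous us.length := by
  induction us with
  | nil => exact isHomogeneous_one _ _
  | cons u us ih =>
    refine IsHomogeneous.sub ?_ ?_
    · rcases us with _ | ⟨u', us⟩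
      · simpa [maxwellPoly] using isHomogeneous_zero ..
      · have h := (isHomogeneous_quadForm B).mul (isHomogeneous_dirDeriv ih u)
        rwa [List.length_cons, Nat.add_sub_cancel, add_comm 2] at h
    · rw [List.length_cons, add_comm us.length, ← zero_add (1 + us.length)]
      exact (isHomogeneous_C _ _).mul ((isHomogeneous_linForm (u ᵥ* B)).mul ih)

theorem maxwellPoly_mem_harmonic [DecidableEq ι] {B : Matrix ι ι R} (hB : B.IsSymm)
    (hdet : IsUnit B.det) (us : List (ι → R)) : maxwellPoly B us ∈ harmonic B us.length := by
  refine mem_harmonic.2 ⟨isHomogeneous_maxwellPoly B us, ?_⟩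
  induction us with
  | nil => exact laplacian_eq_zero_of_le_one B (isHomogeneous_one _ _) zero_le_one
  | cons u us ih =>
    have hM := isHomogeneous_maxwellPoly B us
    rcases us with _ | ⟨u', us⟩
    · exact laplacian_eq_zero_of_le_one B (isHomogeneous_maxwellPoly B [u]) le_rfl
    · rw [maxwellPoly, map_sub, laplacian_quadForm_mul hB hdet (isHomogeneous_dirDeriv hM u),
        laplacian_dirDeriv, ih, ← smul_eq_C_mul, map_smul, laplacian_linForm_mul hB, ih,
        Matrix.vecMul_vecMul, Matrix.mul_nonsing_inv _ hdet, Matrix.vecMul_one, smul_eq_C_mul]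
      simp only [List.length_cons, Nat.add_sub_cancel, map_add, map_sub, map_mul, map_natCast,
        map_ofNat, map_zero]
      push_cast
      ring

/-- The factor `∏_{i < n} (2 - N - 2 i)` by which `maxwellPoly` of `n` vectors of a space of
dimension `N` differs modulo `Q` from a product of `n` linear forms. -/
def maxwellCoeff (R : Type*) [CommRing R] (N n : ℕ) : R :=
  ∏ i ∈ Finset.range n, -(2 * i + N - 2 : R)

theorem maxwellCoeff_ne_zero {K : Type*} [Field K] [CharZero K] {N : ℕ} (hN : 2 < N) (n : ℕ) :
    maxwellCoeff K N n ≠ 0 := by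
  obtain ⟨m, rfl⟩ := Nat.exists_eq_add_of_lt hN
  refine Finset.prod_ne_zero_iff.2 fun i _ => neg_ne_zero.2 ?_
  have h : ((2 * i + m + 1 : ℕ) : K) ≠ 0 := Nat.cast_ne_zero.2 (Nat.succ_ne_zero _)
  convert h using 1
  push_cast
  ring

theorem quadForm_dvd_maxwellPoly_sub (B : Matrix ι ι R) (us : List (ι → R)) :
    quadForm B ∣ maxwellPoly B us - C (maxwellCoeff R (Fintype.card ι) us.length) *
      (us.map fun u => linForm (u ᵥ* B)).prod := by
  induction us with
  | nil => simp [maxwellPoly, maxwellCoeff]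
  | cons u us ih =>
    obtain ⟨T, hT⟩ := ih
    set c : R := 2 * us.length + Fintype.card ι - 2
    have hc : maxwellCoeff R (Fintype.card ι) (u :: us).length =
        maxwellCoeff R (Fintype.card ι) us.length * -c := Finset.prod_range_succ _ _
    refine ⟨dirDeriv u (maxwellPoly B us) - C c * linForm (u ᵥ* B) * T, ?_⟩
    rw [hc, maxwellPoly, List.map_cons, List.prod_cons, map_mul, map_neg]
    linear_combination (-C c * linForm (u ᵥ* B)) * hT

theorem map_maxwellPoly {S : Type*} [CommRing S] (f : R →+* S) (B : Matrix ι ι R)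
    (us : List (ι → R)) :
    map f (maxwellPoly B us) = maxwellPoly (B.map f) (us.map (f ∘ ·)) := by
  induction us with
  | nil => exact map_one _
  | cons u us ih =>
    have hu : f ∘ (u ᵥ* B) = (f ∘ u) ᵥ* B.map f := _root_.funext (RingHom.map_vecMul f B u)
    have h2 : f 2 = 2 := map_ofNat f 2
    simp [maxwellPoly, ih, map_quadForm, map_dirDeriv, map_linForm, hu, h2]

/-- The polynomial that Maxwell's multipole sum is equal to: its `k`-th term is `Q^k` times
`maxwellPoly` of the `k`-th tuple, with the numerical coefficient `lam` if that tuple is empty. -/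
def maxwellSumPoly (B : Matrix ι ι R) (d : ℕ) (u : (k : ℕ) → Fin (d - 2 * k) → ι → R) (lam : R) :
    MvPolynomial ι R :=
  ∑ k ∈ Finset.range (d / 2 + 1),
    quadForm B ^ k * (C (if 2 * k = d then lam else 1) * maxwellPoly B (List.ofFn (u k)))

theorem map_maxwellSumPoly {S : Type*} [CommRing S] (f : R →+* S) (B : Matrix ι ι R) (d : ℕ)
    (u : (k : ℕ) → Fin (d - 2 * k) → ι → R) (lam : R) :
    map f (maxwellSumPoly B d u lam) =
      maxwellSumPoly (B.map f) d (fun k j => f ∘ u k j) (f lam) := by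
  simp only [maxwellSumPoly, map_sum, map_mul, map_pow, map_quadForm, map_C, map_maxwellPoly,
    List.map_ofFn, apply_ite f, map_one]
  rfl

theorem eq_of_quadForm_dvd_sub {K : Type*} [Field K] [CharZero K] [DecidableEq ι] [Nonempty ι]
    {B : Matrix ι ι K} (hB : B.IsSymm) (hdet : IsUnit B.det) {P T : MvPolynomial ι K}
    (hPT : laplacian B P = laplacian B T) (h : quadForm B ∣ P - T) : P = T := by
  refine sub_eq_zero.1 (eq_zero_of_quadForm_sub_dvd hB hdet (c := 0) ?_ ?_)
  · rw [map_sub, hPT, sub_self]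
  · rwa [map_zero, sub_zero]

end Maxwell

section Derivatives

theorem differentiableAt_eval {ι 𝕜 : Type*} [Finite ι] [NontriviallyNormedField 𝕜]
    [CompleteSpace 𝕜] (P : MvPolynomial ι 𝕜) (w : ι → 𝕜) :
    DifferentiableAt 𝕜 (fun z => eval z P) w :=
  have := Fintype.ofFinite ι
  (AnalyticOnNhd.eval_mvPolynomial P w trivial).differentiableAt

theorem fderiv_eval {ι 𝕜 : Type*} [Fintype ι] [NontriviallyNormedField 𝕜] [CompleteSpace 𝕜]
    (P : MvPolynomial ι 𝕜) (w u : ι → 𝕜) :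
    fderiv 𝕜 (fun z => eval z P) w u = eval w (dirDeriv u P) := by
  induction P using MvPolynomial.induction_on with
  | C a => simp
  | add p q hp hq =>
    simp only [map_add]
    rw [fderiv_fun_add (differentiableAt_eval p w) (differentiableAt_eval q w)]
    simp [hp, hq]
  | mul_X p k hp =>
    have hk : HasFDerivAt (fun z : ι → 𝕜 => z k) (ContinuousLinearMap.proj k : (ι → 𝕜) →L[𝕜] 𝕜) w :=
      hasFDerivAt_apply k w
    simp only [map_mul, eval_X]
    rw [fderiv_fun_mul (differentiableAt_eval p w) hk.differentiableAt, hk.fderiv]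
    simp [hp, dirDeriv_X]

variable {B : Matrix (Fin 3) (Fin 3) ℝ} {W : Set (Fin 3 → ℂ)} {s : (Fin 3 → ℂ) → ℂ}

theorem IsSqrtBranch.sq_eq_eval (hs : IsSqrtBranch B W s) {w : Fin 3 → ℂ} (hw : w ∈ W) :
    s w ^ 2 = eval w (quadForm (B.map (algebraMap ℝ ℂ))) := by
  rw [hs.sq_eq w hw, ← map_quadForm, eval_map, aeval_def]
  rfl

theorem IsSqrtBranch.differentiableAt (hs : IsSqrtBranch B W s) {w : Fin 3 → ℂ} (hw : w ∈ W) :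
    DifferentiableAt ℂ s w :=
  (hs.analytic w hw).differentiableAt

theorem IsSqrtBranch.mul_fderiv (hs : IsSqrtBranch B W s) (hB : B.IsSymm) {w : Fin 3 → ℂ}
    (hw : w ∈ W) (u : Fin 3 → ℂ) :
    s w * fderiv ℂ s w u = eval w (linForm (u ᵥ* B.map (algebraMap ℝ ℂ))) := by
  have hsq : (fun z => s z ^ 2) =ᶠ[nhds w] fun z => eval z (quadForm (B.map (algebraMap ℝ ℂ))) := by
    filter_upwards [hs.isOpen.mem_nhds hw] with z hz using hs.sq_eq_eval hz
  have h := congrArg (fun L => L u) (hsq.fderiv_eq (𝕜 := ℂ))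
  simp only [fderiv_eval, dirDeriv_quadForm (hB.map _), map_mul, map_ofNat] at h
  rw [((hs.differentiableAt hw).hasFDerivAt.pow 2).fderiv] at h
  refine mul_left_cancel₀ (two_ne_zero (α := ℂ)) ?_
  simpa [mul_assoc] using h

theorem fderiv_eval_mul_inv_pow {ι : Type*} [Fintype ι] {s : (ι → ℂ) → ℂ} {w : ι → ℂ}
    (hs : DifferentiableAt ℂ s w) (h0 : s w ≠ 0) (P : MvPolynomial ι ℂ) (m : ℕ) (u : ι → ℂ) :
    fderiv ℂ (fun z => eval z P * (s z)⁻¹ ^ m) w u =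
      (s w ^ 2 * eval w (dirDeriv u P) - m * (s w * fderiv ℂ s w u * eval w P)) *
        (s w)⁻¹ ^ (m + 2) := by
  have hinv : HasFDerivAt (fun z => (s z)⁻¹) (-(s w ^ 2)⁻¹ • fderiv ℂ s w) w :=
    (hasDerivAt_inv h0).comp_hasFDerivAt w hs.hasFDerivAt
  rw [fderiv_fun_mul (differentiableAt_eval P w) (hinv.pow m).differentiableAt, (hinv.pow m).fderiv]
  rcases m with _ | m
  · simp [fderiv_eval, mul_comm (s w ^ 2), h0]
  · simp only [Nat.add_sub_cancel, inv_pow, nsmul_eq_mul, Nat.cast_add, Nat.cast_one, add_apply,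
      smul_apply, smul_eq_mul, neg_mul, mul_neg, fderiv_eval]
    field_simp
    ring

theorem IsSqrtBranch.iterDir_inv (hs : IsSqrtBranch B W s) (hB : B.IsSymm)
    (us : List (Fin 3 → ℂ)) {w : Fin 3 → ℂ} (hw : w ∈ W) :
    iterDir us (fun z => (s z)⁻¹) w =
      eval w (maxwellPoly (B.map (algebraMap ℝ ℂ)) us) * (s w)⁻¹ ^ (2 * us.length + 1) := by
  induction us generalizing w with
  | nil => simp [iterDir, maxwellPoly]
  | cons u us ih =>
    have hev : iterDir us (fun z => (s z)⁻¹) =ᶠ[nhds w] fun z =>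
        eval z (maxwellPoly (B.map (algebraMap ℝ ℂ)) us) * (s z)⁻¹ ^ (2 * us.length + 1) := by
      filter_upwards [hs.isOpen.mem_nhds hw] with z hz using ih hz
    calc iterDir (u :: us) (fun z => (s z)⁻¹) w
        = fderiv ℂ (iterDir us fun z => (s z)⁻¹) w u := rfl
      _ = _ := by
        rw [hev.fderiv_eq, fderiv_eval_mul_inv_pow (hs.differentiableAt hw) (hs.ne_zero w hw),
          hs.mul_fderiv hB hw, hs.sq_eq_eval hw, List.length_cons, mul_add, mul_one,
          add_right_comm, maxwellPoly]
        simp only [map_sub, map_mul, eval_C, Fintype.card_fin]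
        push_cast
        ring

theorem IsSqrtBranch.maxwellSum_eq (hs : IsSqrtBranch B W s) (hB : B.IsSymm) (d : ℕ)
    (u : (k : ℕ) → Fin (d - 2 * k) → Fin 3 → ℂ) (lam : ℝ) {w : Fin 3 → ℂ} (hw : w ∈ W) :
    maxwellSum d u lam s w = eval w (maxwellSumPoly (B.map (algebraMap ℝ ℂ)) d u lam) := by
  rw [maxwellSumPoly, map_sum]
  refine Finset.sum_congr rfl fun k hk => ?_
  rw [Finset.mem_range] at hk
  have h0 := hs.ne_zero w hw
  rw [hs.iterDir_inv hB _ hw, map_mul, map_mul, map_pow, eval_C, ← hs.sq_eq_eval hw,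
    List.length_ofFn, ← pow_mul,
    show 2 * (d - k) + 1 = 2 * k + (2 * (d - 2 * k) + 1) by omega, pow_add, inv_pow]
  field_simp

end Derivatives

section Cone

open Complex (I)

theorem eval₂_mul_of_isHomogeneous {σ R S : Type*} [CommSemiring R] [CommSemiring S]
    {P : MvPolynomial σ R} {n : ℕ} (hP : P.IsHomogeneous n) (f : R →+* S) (c : S) (x : σ → S) :
    eval₂ f (fun i => c * x i) P = c ^ n * eval₂ f x P := by
  rw [eval₂_eq, eval₂_eq, Finset.mul_sum]
  refine Finset.sum_congr rfl fun s hs => ?_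
  have hdeg : ∑ i ∈ s.support, s i = n := by
    rw [← hP (mem_support_iff.1 hs), Finsupp.weight_apply, Finsupp.sum]
    simp only [Pi.one_apply, smul_eq_mul, mul_one]
  rw [mul_left_comm, ← hdeg, ← Finset.prod_pow_eq_pow_sum, ← Finset.prod_mul_distrib]
  simp only [mul_pow]

/-- The point `((1 - t²)/2, -i (1 + t²)/2, t)` with coordinates in `ℂ[t]`: the general line of the
isotropic cone `x₀² + x₁² + x₂² = 0` is spanned by its value at some `t`. -/
def coneVec : Fin 3 → Polynomial ℂ :=
  ![Polynomial.C (1 / 2) * (1 - Polynomial.X ^ 2), Polynomial.C (-I / 2) * (1 + Polynomial.X ^ 2),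
    Polynomial.X]

/-- Restriction of polynomials to the rational curve `coneVec` on the isotropic cone. -/
def restrictCone : MvPolynomial (Fin 3) ℂ →ₐ[ℂ] Polynomial ℂ :=
  aeval coneVec

/-- The restriction of the linear form with coefficient vector `u` to the curve `coneVec`, a
polynomial of degree at most `2`. -/
def coneQuad : (Fin 3 → ℂ) →ₗ[ℂ] Polynomial ℂ :=
  Fintype.linearCombination ℂ coneVec

theorem restrictCone_C (a : ℂ) : restrictCone (C a) = Polynomial.C a :=
  algHom_C restrictCone a

theorem restrictCone_linForm (u : Fin 3 → ℂ) : restrictCone (linForm u) = coneQuad u := by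
  simp [restrictCone, linForm, coneQuad, Fintype.linearCombination_apply, Polynomial.smul_eq_C_mul]

theorem coneQuad_eq (u : Fin 3 → ℂ) : coneQuad u = Polynomial.C ((u 0 - I * u 1) / 2) +
    Polynomial.C (u 2) * Polynomial.X - Polynomial.C ((u 0 + I * u 1) / 2) * Polynomial.X ^ 2 := by
  refine Polynomial.funext fun t => ?_
  simp [coneQuad, coneVec, Fintype.linearCombination_apply, Fin.sum_univ_three]
  ring

theorem eval_restrictCone (t : ℂ) (P : MvPolynomial (Fin 3) ℂ) :
    (restrictCone P).eval t = eval (fun i => (coneVec i).eval t) P := by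
  rw [restrictCone, aeval_def, ← Polynomial.coe_evalRingHom, hom_eval₂]
  exact congrArg (fun f => eval₂ f _ P) (RingHom.ext fun a => Polynomial.eval_C)

theorem eval_smul_coneVec {P : MvPolynomial (Fin 3) ℂ} {n : ℕ} (hP : P.IsHomogeneous n) (c t : ℂ) :
    eval (fun i => c * (coneVec i).eval t) P = c ^ n * (restrictCone P).eval t := by
  rw [eval_restrictCone]
  exact eval₂_mul_of_isHomogeneous hP (RingHom.id ℂ) c _

theorem restrictCone_quadForm_one : restrictCone (quadForm 1) = 0 := by
  refine Polynomial.funext fun t => ?_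
  rw [← Matrix.diagonal_one, quadForm_diagonal, eval_restrictCone]
  simp [Fin.sum_univ_three, coneVec]
  linear_combination (1 + t ^ 2) ^ 2 / 4 * Complex.I_sq

theorem natDegree_restrictCone_le {P : MvPolynomial (Fin 3) ℂ} {n : ℕ} (hP : P.IsHomogeneous n) :
    (restrictCone P).natDegree ≤ 2 * n := by
  rw [mul_comm]
  refine aeval_natDegree_le P hP.totalDegree_le _ fun i => ?_
  fin_cases i
  · change (Polynomial.C (1 / 2) * (1 - Polynomial.X ^ 2) : Polynomial ℂ).natDegree ≤ 2
    compute_degree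
  · change (Polynomial.C (-I / 2) * (1 + Polynomial.X ^ 2)).natDegree ≤ 2
    compute_degree
  · exact Polynomial.natDegree_X_le.trans one_le_two

theorem eq_smul_eval_coneVec {x : Fin 3 → ℂ} (hx : x 0 ^ 2 + x 1 ^ 2 + x 2 ^ 2 = 0)
    (hz : x 0 + I * x 1 ≠ 0) :
    x = fun i => (x 0 + I * x 1) * (coneVec i).eval (x 2 / (x 0 + I * x 1)) := by
  have hsq : (x 0 + I * x 1) * (x 2 / (x 0 + I * x 1)) ^ 2 = -(x 0 - I * x 1) := by
    field_simp
    linear_combination hx - x 1 ^ 2 * Complex.I_sq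
  ext i
  fin_cases i
  · simp [coneVec]
    linear_combination hsq / 2
  · simp [coneVec]
    linear_combination I * hsq / 2 + x 1 * Complex.I_sq
  · simp [coneVec, mul_div_cancel₀ _ hz]

theorem quadForm_one_dvd_of_restrictCone_eq_zero {P : MvPolynomial (Fin 3) ℂ} {n : ℕ}
    (hP : P.IsHomogeneous n) (h0 : restrictCone P = 0) : quadForm 1 ∣ P := by
  let g : MvPolynomial (Fin 2) ℂ := X 1 * (X 0 ^ 2 + X 1 ^ 2)
  have hg : g ≠ 0 := fun h => by
    have h1 := congrArg (eval fun _ => (1 : ℂ)) h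
    norm_num [g] at h1
  have hQ (y : ℂ) (x : Fin 2 → ℂ) : eval (Fin.cons y x : Fin 3 → ℂ) (quadForm 1) =
      y ^ 2 + (x 0 ^ 2 + x 1 ^ 2) := by
    rw [← Matrix.diagonal_one, eval_cons_quadForm_diagonal, Fin.sum_univ_two]
    simp only [one_mul]
  have key := quadForm_diagonal_sub_dvd (d := fun _ => (1 : ℂ)) one_ne_zero (c := 0)
    (S := {x | eval x g ≠ 0}) (P := P) (fun f hf => ?_) (fun x hx => ?_) fun x hx y hy => ?_
  · rwa [Matrix.diagonal_one, map_zero, sub_zero] at key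
  · refine (mul_eq_zero.1 (MvPolynomial.funext fun x => ?_ : f * g = 0)).resolve_right hg
    by_cases hx : eval x g = 0
    · rw [map_mul, hx, mul_zero, map_zero]
    · rw [map_mul, hf x hx, zero_mul, map_zero]
  · obtain ⟨y, hy⟩ := IsAlgClosed.exists_pow_nat_eq (-(x 0 ^ 2 + x 1 ^ 2)) (n := 2) two_pos
    refine ⟨y, fun hy0 => hx ?_, by rw [Matrix.diagonal_one, hQ, hy, neg_add_cancel]⟩
    have h : x 0 ^ 2 + x 1 ^ 2 = 0 := by
      rw [← neg_eq_zero, ← hy, hy0, zero_pow two_ne_zero]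
    simp [g, h]
  · rw [Matrix.diagonal_one, hQ] at hy
    have hz : y + I * x 0 ≠ 0 := fun hz => hx (by
      have h1 : x 1 ^ 2 = 0 := by
        linear_combination hy - (y - I * x 0) * hz - x 0 ^ 2 * Complex.I_sq
      simp [g, pow_eq_zero_iff two_ne_zero |>.1 h1])
    rw [eq_smul_eval_coneVec (x := Fin.cons y x) (by rw [add_assoc]; exact hy) hz,
      eval_smul_coneVec hP, h0, Polynomial.eval_zero, mul_zero]

theorem exists_coneQuad_eq {q : Polynomial ℂ} (hq : q.natDegree ≤ 2) : ∃ u, coneQuad u = q := by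
  refine ⟨![q.coeff 0 - q.coeff 2, I * (q.coeff 0 + q.coeff 2), q.coeff 1], ?_⟩
  rw [Polynomial.as_sum_range_C_mul_X_pow' q (Nat.lt_succ_of_le hq), coneQuad_eq]
  refine Polynomial.funext fun t => ?_
  simp [Finset.sum_range_succ]
  linear_combination (-(q.coeff 0 + q.coeff 2) / 2 * (1 + t ^ 2)) * Complex.I_sq

theorem exists_eq_mul_of_natDegree_le {K : Type*} [Field K] [IsAlgClosed K] {f : Polynomial K}
    {m : ℕ} (hf : f.natDegree ≤ m + 1) :
    ∃ p g : Polynomial K, f = p * g ∧ p.natDegree ≤ 1 ∧ g.natDegree ≤ m := by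
  rcases Nat.eq_zero_or_pos f.natDegree with h0 | hpos
  · exact ⟨1, f, (one_mul f).symm, by simp, by omega⟩
  obtain ⟨r, hr⟩ := IsAlgClosed.exists_root f (Polynomial.natDegree_pos_iff_degree_pos.1 hpos).ne'
  refine ⟨Polynomial.X - Polynomial.C r, f /ₘ (Polynomial.X - Polynomial.C r),
    (Polynomial.mul_divByMonic_eq_iff_isRoot.2 hr).symm, Polynomial.natDegree_X_sub_C_le r, ?_⟩
  rw [Polynomial.natDegree_divByMonic f (Polynomial.monic_X_sub_C r), Polynomial.natDegree_X_sub_C]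
  omega

theorem exists_eq_prod_coneQuad {n : ℕ} {f : Polynomial ℂ} (hf : f.natDegree ≤ 2 * (n + 1)) :
    ∃ u : Fin (n + 1) → Fin 3 → ℂ, f = ∏ j, coneQuad (u j) := by
  induction n generalizing f with
  | zero =>
    obtain ⟨u, hu⟩ := exists_coneQuad_eq hf
    exact ⟨fun _ => u, by rw [Fin.prod_univ_one, hu]⟩
  | succ n ih =>
    obtain ⟨p, g, rfl, hp, hg⟩ := exists_eq_mul_of_natDegree_le hf
    obtain ⟨p', g', rfl, hp', hg'⟩ := exists_eq_mul_of_natDegree_le hg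
    obtain ⟨v, hv⟩ := exists_coneQuad_eq (q := p * p')
      (Polynomial.natDegree_mul_le.trans (add_le_add hp hp'))
    obtain ⟨u, rfl⟩ := ih hg'
    refine ⟨Fin.cons v u, ?_⟩
    rw [Fin.prod_univ_succ (n := n + 1), ← mul_assoc]
    simp only [Fin.cons_zero, Fin.cons_succ, hv]

end Cone

section Multipoles

variable {R : Type*} [CommRing R] {ι : Type*} [Fintype ι] [DecidableEq ι]

theorem isUnit_det_of_mul_transpose_eq {A B : Matrix ι ι R} (hA : A * Aᵀ = B)
    (hdet : IsUnit B.det) : IsUnit A.det := by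
  rw [← hA, Matrix.det_mul] at hdet
  exact isUnit_of_mul_isUnit_left hdet

theorem inv_mul_mul_transpose_inv_eq_one {A B : Matrix ι ι R} (hA : A * Aᵀ = B)
    (hdet : IsUnit B.det) : A⁻¹ * B * A⁻¹ᵀ = 1 := by
  have hU := isUnit_det_of_mul_transpose_eq hA hdet
  rw [← hA, ← Matrix.mul_assoc, Matrix.nonsing_inv_mul _ hU, Matrix.one_mul,
    ← Matrix.transpose_mul, Matrix.nonsing_inv_mul _ hU, Matrix.transpose_one]

theorem subst_inv_quadForm {A B : Matrix ι ι R} (hA : A * Aᵀ = B) (hdet : IsUnit B.det) :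
    subst A⁻¹ (quadForm B) = quadForm 1 := by
  rw [subst_quadForm, inv_mul_mul_transpose_inv_eq_one hA hdet]

theorem subst_inv_linForm {A B : Matrix ι ι R} (hA : A * Aᵀ = B) (hdet : IsUnit B.det)
    (u : ι → R) : subst A⁻¹ (linForm (u ᵥ* B)) = linForm (u ᵥ* A) := by
  rw [subst_linForm, Matrix.vecMul_vecMul, ← hA, Matrix.mul_assoc, ← Matrix.transpose_mul,
    Matrix.nonsing_inv_mul _ (isUnit_det_of_mul_transpose_eq hA hdet), Matrix.transpose_one,
    Matrix.mul_one]

variable {A B : Matrix (Fin 3) (Fin 3) ℂ}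

theorem restrictCone_subst_maxwellPoly (hA : A * Aᵀ = B) (hdet : IsUnit B.det) {n : ℕ}
    (u : Fin n → Fin 3 → ℂ) : restrictCone (subst A⁻¹ (maxwellPoly B (List.ofFn u))) =
      Polynomial.C (maxwellCoeff ℂ 3 n) * ∏ j, coneQuad (u j ᵥ* A) := by
  obtain ⟨T, hT⟩ := quadForm_dvd_maxwellPoly_sub B (List.ofFn u)
  have hC (a : ℂ) : restrictCone (subst A⁻¹ (C a)) = Polynomial.C a := by
    rw [algHom_C, algebraMap_eq, restrictCone_C]
  rw [sub_eq_iff_eq_add.1 hT]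
  simp only [map_add, map_mul, hC, subst_inv_quadForm hA hdet, restrictCone_quadForm_one, zero_mul,
    zero_add, List.map_ofFn, List.prod_ofFn, map_prod, Function.comp_apply,
    subst_inv_linForm hA hdet, restrictCone_linForm, List.length_ofFn, Fintype.card_fin]

theorem eq_of_restrictCone_subst_eq (hA : A * Aᵀ = B) (hdet : IsUnit B.det) {n : ℕ}
    {P T : MvPolynomial (Fin 3) ℂ} (hP : P ∈ harmonic B n) (hT : T ∈ harmonic B n)
    (h : restrictCone (subst A⁻¹ P) = restrictCone (subst A⁻¹ T)) : P = T := by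
  have hU := isUnit_det_of_mul_transpose_eq hA hdet
  have hB : B.IsSymm := hA ▸ Matrix.isSymm_mul_transpose_self A
  refine eq_of_quadForm_dvd_sub hB hdet ((mem_harmonic.1 hP).2.trans (mem_harmonic.1 hT).2.symm) ?_
  have hdvd := quadForm_one_dvd_of_restrictCone_eq_zero (isHomogeneous_subst A⁻¹ (hP.1.sub hT.1))
    (by rw [map_sub, map_sub, h, sub_self])
  rw [← subst_inv_quadForm hA hdet] at hdvd
  simpa only [subst_subst, Matrix.mul_nonsing_inv _ hU, subst_one] using map_dvd (subst A) hdvd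

theorem eq_maxwellPoly_of_restrictCone_subst (hA : A * Aᵀ = B) (hdet : IsUnit B.det) {n : ℕ}
    {H : MvPolynomial (Fin 3) ℂ} (hH : H ∈ harmonic B n) {u : Fin n → Fin 3 → ℂ}
    (h : restrictCone (subst A⁻¹ H) =
      Polynomial.C (maxwellCoeff ℂ 3 n) * ∏ j, coneQuad (u j ᵥ* A)) :
    H = maxwellPoly B (List.ofFn u) := by
  have hM := maxwellPoly_mem_harmonic (hA ▸ Matrix.isSymm_mul_transpose_self A) hdet (List.ofFn u)
  rw [List.length_ofFn] at hM
  exact eq_of_restrictCone_subst_eq hA hdet hH hM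
    (h.trans (restrictCone_subst_maxwellPoly hA hdet u).symm)

theorem exists_eq_maxwellPoly (hA : A * Aᵀ = B) (hdet : IsUnit B.det) {n : ℕ}
    {H : MvPolynomial (Fin 3) ℂ} (hH : H ∈ harmonic B (n + 1)) :
    ∃ u : Fin (n + 1) → Fin 3 → ℂ, H = maxwellPoly B (List.ofFn u) := by
  set κ : ℂ := maxwellCoeff ℂ 3 (n + 1)
  have hκ : κ ≠ 0 := maxwellCoeff_ne_zero (by norm_num) _
  have hU := isUnit_det_of_mul_transpose_eq hA hdet
  obtain ⟨w, hw⟩ := exists_eq_prod_coneQuad (n := n) (f := restrictCone (subst A⁻¹ (κ⁻¹ • H)))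
    (natDegree_restrictCone_le (isHomogeneous_subst _ (Submodule.smul_mem _ _ hH).1))
  refine ⟨fun j => w j ᵥ* A⁻¹, eq_maxwellPoly_of_restrictCone_subst hA hdet hH ?_⟩
  simp only [Matrix.vecMul_vecMul, Matrix.nonsing_inv_mul _ hU, Matrix.vecMul_one]
  rw [← hw, map_smul, map_smul, Polynomial.smul_eq_C_mul, ← mul_assoc, ← map_mul,
    mul_inv_cancel₀ hκ, map_one, one_mul]

end Multipoles

section MatrixFactorization

theorem exists_mul_transpose_eq_of_mul_mul_transpose_eq {ι R : Type*} [Fintype ι] [DecidableEq ι]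
    [CommRing R] {B U : Matrix ι ι R} {d s : ι → R} (hU : IsUnit U.det)
    (hd : U * B * Uᵀ = Matrix.diagonal d) (hs : ∀ i, s i * s i = d i) :
    ∃ A : Matrix ι ι R, A * Aᵀ = B := by
  refine ⟨U⁻¹ * Matrix.diagonal s, ?_⟩
  calc U⁻¹ * Matrix.diagonal s * (U⁻¹ * Matrix.diagonal s)ᵀ
      = U⁻¹ * (Matrix.diagonal s * Matrix.diagonal s) * U⁻¹ᵀ := by
        rw [Matrix.transpose_mul, Matrix.diagonal_transpose]
        simp only [Matrix.mul_assoc]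
    _ = U⁻¹ * (U * B * Uᵀ) * U⁻¹ᵀ := by
        rw [Matrix.diagonal_mul_diagonal, hd, _root_.funext hs]
    _ = U⁻¹ * U * B * (U⁻¹ * U)ᵀ := by
        rw [Matrix.transpose_mul]
        simp only [Matrix.mul_assoc]
    _ = B := by
        rw [Matrix.nonsing_inv_mul _ hU, Matrix.one_mul, Matrix.transpose_one, Matrix.mul_one]

theorem exists_mul_transpose_eq_map {ι : Type*} [Fintype ι] {B : Matrix ι ι ℝ} (hB : B.IsSymm) :
    ∃ A : Matrix ι ι ℂ, A * Aᵀ = B.map (algebraMap ℝ ℂ) := by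
  classical
  obtain ⟨U, d, hU, hd⟩ := exists_mul_mul_transpose_eq_diagonal hB
  choose s hs using fun i => IsAlgClosed.exists_pow_nat_eq (d i : ℂ) two_pos
  refine exists_mul_transpose_eq_of_mul_mul_transpose_eq (isUnit_det_map (algebraMap ℝ ℂ) hU) ?_
    fun i => (sq (s i)).symm.trans (hs i)
  rw [← Matrix.map_mul, ← Matrix.transpose_map, ← Matrix.map_mul, hd,
    Matrix.diagonal_map (map_zero _)]
  rfl

open scoped MatrixOrder in
theorem exists_mul_transpose_eq_of_posDef {ι : Type*} [Fintype ι] {B : Matrix ι ι ℝ}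
    (hB : B.PosDef) : ∃ A : Matrix ι ι ℝ, A * Aᵀ = B := by
  classical
  obtain ⟨A, rfl⟩ := CStarAlgebra.nonneg_iff_eq_star_mul_self.1 hB.posSemidef.nonneg
  exact ⟨Aᵀ, by rw [Matrix.transpose_transpose, Matrix.star_eq_conjTranspose,
    Matrix.conjTranspose_eq_transpose_of_trivial]⟩

end MatrixFactorization

section RealStructure

open Complex (I)
open LaurentPolynomial (T)
open scoped LaurentPolynomial

/-- The conjugation of the functions on `ℂ \ {0}` by the antipodal map `t ↦ -1 / conj t` of the
Riemann sphere, on Laurent polynomials. -/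
def antipodalConj : ℂ[T;T⁻¹] →+* ℂ[T;T⁻¹] :=
  LaurentPolynomial.eval₂ (LaurentPolynomial.C.comp (starRingEnd ℂ))
    (-⟨T (-1), T 1, by rw [← LaurentPolynomial.T_add]; rfl, by rw [← LaurentPolynomial.T_add]; rfl⟩)

theorem antipodalConj_C (a : ℂ) :
    antipodalConj (LaurentPolynomial.C a) = LaurentPolynomial.C (conj a) := by
  simp [antipodalConj]

theorem antipodalConj_T_one : antipodalConj (T 1) = -T (-1) := by
  simp [antipodalConj]

theorem antipodalConj_T_neg (n : ℕ) : antipodalConj (T (-n)) = (-1) ^ n * T n := by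
  simp [antipodalConj, neg_pow (T 1 : ℂ[T;T⁻¹])]

theorem antipodalConj_toLaurent (f : Polynomial ℂ) : antipodalConj (Polynomial.toLaurent f) =
    LaurentPolynomial.invert
      (Polynomial.toLaurent ((f.map (starRingEnd ℂ)).comp (-Polynomial.X))) := by
  induction f using Polynomial.induction_on' with
  | add p q hp hq => simp only [map_add, Polynomial.map_add, Polynomial.add_comp, hp, hq]
  | monomial n a =>
    rw [← Polynomial.C_mul_X_pow_eq_monomial]
    rw [map_mul, map_mul, Polynomial.toLaurent_C, antipodalConj_C, Polynomial.toLaurent_X_pow,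
      ← mul_one (n : ℤ), ← LaurentPolynomial.T_pow, map_pow, antipodalConj_T_one]
    simp [neg_pow (Polynomial.X : Polynomial ℂ), neg_pow (T _ : ℂ[T;T⁻¹])]

/-- A polynomial that is real as a form of degree `2 n` on the Riemann sphere: the function
`f(t) / t ^ n` is invariant under `antipodalConj`. -/
def IsAntipodal (n : ℕ) (f : Polynomial ℂ) : Prop :=
  antipodalConj (Polynomial.toLaurent f * T (-n)) = Polynomial.toLaurent f * T (-n)

theorem IsAntipodal.mul_X_pow_natDegree {n : ℕ} {f : Polynomial ℂ} (hf : IsAntipodal n f) :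
    f * Polynomial.X ^ f.natDegree = Polynomial.C ((-1) ^ n) * Polynomial.X ^ (2 * n) *
      ((f.map (starRingEnd ℂ)).comp (-Polynomial.X)).reverse := by
  have hdeg : ((f.map (starRingEnd ℂ)).comp (-Polynomial.X)).natDegree = f.natDegree := by
    simp [Polynomial.natDegree_comp]
  rw [IsAntipodal, map_mul, antipodalConj_toLaurent, antipodalConj_T_neg] at hf
  refine Polynomial.toLaurent_injective ?_
  rw [map_mul, map_mul, map_mul, LaurentPolynomial.toLaurent_reverse, hdeg,
    Polynomial.toLaurent_X_pow, Polynomial.toLaurent_X_pow]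
  calc Polynomial.toLaurent f * T f.natDegree
      = Polynomial.toLaurent f * T (-n) * (T n * T f.natDegree) := by
        rw [mul_assoc, ← mul_assoc (T (-n)), ← LaurentPolynomial.T_add, neg_add_cancel,
          LaurentPolynomial.T_zero, one_mul]
    _ = _ := by
        rw [← hf, Nat.cast_mul, Nat.cast_two, two_mul (n : ℤ), LaurentPolynomial.T_add]
        simp only [map_pow, map_neg, map_one]
        ring

theorem IsAntipodal.of_mul {m n : ℕ} {f g : Polynomial ℂ} (hf : IsAntipodal m f)
    (hfg : IsAntipodal (m + n) (f * g)) (hf0 : f ≠ 0) : IsAntipodal n g := by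
  have hsplit : Polynomial.toLaurent (f * g) * T (-(m + n : ℕ)) =
      (Polynomial.toLaurent f * T (-m)) * (Polynomial.toLaurent g * T (-n)) := by
    rw [map_mul, Nat.cast_add, neg_add, LaurentPolynomial.T_add]
    ring
  rw [IsAntipodal, hsplit, map_mul, hf] at hfg
  refine mul_left_cancel₀ (mul_ne_zero ?_ (LaurentPolynomial.isUnit_T _).ne_zero) hfg
  exact Polynomial.toLaurent_ne_zero.2 hf0

theorem IsAntipodal.exists_eq_C {f : Polynomial ℂ} (hf : IsAntipodal 0 f) :
    ∃ a : ℝ, f = Polynomial.C (a : ℂ) := by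
  have h := hf.mul_X_pow_natDegree
  simp only [pow_zero, map_one, mul_zero, one_mul] at h
  have hdeg : f.natDegree = 0 := by
    by_contra h0
    have h1 := congrArg Polynomial.natDegree h
    rw [Polynomial.natDegree_mul_X_pow _ (by rintro rfl; exact h0 Polynomial.natDegree_zero)] at h1
    have h2 := ((f.map (starRingEnd ℂ)).comp (-Polynomial.X)).reverse_natDegree_le
    simp [Polynomial.natDegree_comp] at h2
    omega
  rw [Polynomial.eq_C_of_natDegree_eq_zero hdeg] at h ⊢
  obtain ⟨a, ha⟩ := Complex.conj_eq_iff_real.1 (by simpa using h.symm : conj (f.coeff 0) = _)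
  exact ⟨a, by rw [ha]⟩

theorem IsAntipodal.exists_isRoot {n : ℕ} {f : Polynomial ℂ} (hf : IsAntipodal (n + 1) f)
    (hf0 : f ≠ 0) : ∃ r, f.IsRoot r := by
  refine IsAlgClosed.exists_root f fun hdeg => hf0 ?_
  have h := congrArg (Polynomial.eval 0) hf.mul_X_pow_natDegree
  rw [Polynomial.eq_C_of_degree_eq_zero hdeg] at h ⊢
  have h0 : f.coeff 0 = 0 := by simpa using h
  rw [h0, map_zero]

theorem IsAntipodal.dvd_of_isRoot {n : ℕ} {f : Polynomial ℂ} (hf : IsAntipodal n f) {r : ℂ}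
    (hr : f.IsRoot r) : Polynomial.C (conj r) * Polynomial.X + 1 ∣ f := by
  rcases eq_or_ne r 0 with rfl | hr0
  · simp
  have hc : conj r ≠ 0 := by simpa using hr0
  have hroot : (f * Polynomial.X ^ f.natDegree).IsRoot (-(conj r)⁻¹) := by
    have hinv : Invertible (-conj r) := invertibleOfNonzero (neg_ne_zero.2 hc)
    have h := (Polynomial.eval₂_reverse_eq_zero_iff (RingHom.id ℂ) (-conj r)
      ((f.map (starRingEnd ℂ)).comp (-Polynomial.X))).2
    rw [hf.mul_X_pow_natDegree, Polynomial.IsRoot, Polynomial.eval_mul]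
    refine mul_eq_zero_of_right _ ?_
    simpa using h (by simpa using hr)
  have hroot' : f.IsRoot (-(conj r)⁻¹) := by
    simpa [hr0] using hroot
  obtain ⟨g, rfl⟩ := Polynomial.dvd_iff_isRoot.2 hroot'
  refine Dvd.intro (Polynomial.C (conj r)⁻¹ * g) ?_
  have hC : Polynomial.C (conj r) * Polynomial.C (conj r)⁻¹ = 1 := by
    rw [← map_mul, mul_inv_cancel₀ hc, map_one]
  rw [map_neg]
  linear_combination Polynomial.X * g * hC

/-- The curve `coneVec` divided by its parameter, which makes it commute with the antipodal map. -/
def laurentConeVec : Fin 3 → ℂ[T;T⁻¹] :=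
  ![LaurentPolynomial.C (1 / 2) * (T (-1) - T 1), LaurentPolynomial.C (-I / 2) * (T (-1) + T 1), 1]

theorem toLaurent_coneVec (i : Fin 3) :
    Polynomial.toLaurent (coneVec i) = T 1 * laurentConeVec i := by
  have hT : (T 1 * T (-1) : ℂ[T;T⁻¹]) = 1 := by rw [← LaurentPolynomial.T_add]; rfl
  fin_cases i
  · change Polynomial.toLaurent (Polynomial.C (1 / 2) * (1 - Polynomial.X ^ 2)) =
      T 1 * (LaurentPolynomial.C (1 / 2) * (T (-1) - T 1))
    rw [map_mul, Polynomial.toLaurent_C, map_sub, map_one, map_pow, Polynomial.toLaurent_X]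
    linear_combination -LaurentPolynomial.C (1 / 2) * hT
  · change Polynomial.toLaurent (Polynomial.C (-I / 2) * (1 + Polynomial.X ^ 2)) =
      T 1 * (LaurentPolynomial.C (-I / 2) * (T (-1) + T 1))
    rw [map_mul, Polynomial.toLaurent_C, map_add, map_one, map_pow, Polynomial.toLaurent_X]
    linear_combination -LaurentPolynomial.C (-I / 2) * hT
  · exact Polynomial.toLaurent_X.trans (mul_one _).symm

theorem antipodalConj_laurentConeVec (i : Fin 3) :
    antipodalConj (laurentConeVec i) = laurentConeVec i := by
  have hT : antipodalConj (T (-1)) = -T 1 := by simpa using antipodalConj_T_neg 1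
  fin_cases i
  · change antipodalConj (LaurentPolynomial.C (1 / 2) * (T (-1) - T 1)) =
      LaurentPolynomial.C (1 / 2) * (T (-1) - T 1)
    rw [map_mul, map_sub, hT, antipodalConj_T_one, antipodalConj_C,
      (by simp [Complex.conj_ofNat] : conj (1 / 2 : ℂ) = 1 / 2)]
    ring
  · change antipodalConj (LaurentPolynomial.C (-I / 2) * (T (-1) + T 1)) =
      LaurentPolynomial.C (-I / 2) * (T (-1) + T 1)
    rw [map_mul, map_add, hT, antipodalConj_T_one, antipodalConj_C,
      (by simp [neg_div, Complex.conj_ofNat] : conj (-I / 2 : ℂ) = -(-I / 2)), map_neg]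
    ring
  · exact map_one _

theorem isAntipodal_restrictCone_map {P : MvPolynomial (Fin 3) ℝ} {n : ℕ}
    (hP : P.IsHomogeneous n) :
    IsAntipodal n (restrictCone (MvPolynomial.map (algebraMap ℝ ℂ) P)) := by
  let f : ℝ →+* ℂ[T;T⁻¹] := LaurentPolynomial.C.comp (algebraMap ℝ ℂ)
  have hf : antipodalConj.comp f = f := RingHom.ext fun a => by simp [f, antipodalConj_C]
  have hfC : (Polynomial.toLaurent.comp (algebraMap ℂ (Polynomial ℂ))).comp (algebraMap ℝ ℂ) = f :=
    RingHom.ext fun a => Polynomial.toLaurent_C _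
  have heq : Polynomial.toLaurent (restrictCone (MvPolynomial.map (algebraMap ℝ ℂ) P)) * T (-n) =
      eval₂ f laurentConeVec P := by
    rw [restrictCone, aeval_def, eval₂_map, hom_eval₂, ← RingHom.comp_assoc, hfC,
      _root_.funext toLaurent_coneVec, eval₂_mul_of_isHomogeneous hP, LaurentPolynomial.T_pow,
      mul_one, mul_right_comm, ← LaurentPolynomial.T_add, add_neg_cancel, LaurentPolynomial.T_zero,
      one_mul]
  rw [IsAntipodal, heq, hom_eval₂, hf]
  exact congrArg (fun x => eval₂ f x P) (_root_.funext antipodalConj_laurentConeVec)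

theorem C_ofReal_mul (a : ℝ) (f : Polynomial ℂ) : Polynomial.C (a : ℂ) * f = a • f :=
  Polynomial.ext fun n => by rw [Polynomial.coeff_C_mul, Polynomial.coeff_smul, Complex.real_smul]

/-- The polynomials `coneQuad u` for real vectors `u`, as a real-linear map. -/
def realConeQuad : (Fin 3 → ℝ) →ₗ[ℝ] Polynomial ℂ :=
  Fintype.linearCombination ℝ coneVec

theorem coneQuad_algebraMap_comp (u : Fin 3 → ℝ) :
    coneQuad (algebraMap ℝ ℂ ∘ u) = realConeQuad u := by
  simp [coneQuad, realConeQuad, Fintype.linearCombination_apply]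

theorem realConeQuad_injective : Function.Injective realConeQuad := by
  refine (injective_iff_map_eq_zero _).2 fun u hu => ?_
  rw [← coneQuad_algebraMap_comp, coneQuad_eq] at hu
  have h01 : u 0 = 0 ∧ u 1 = 0 := by
    simpa [Complex.ext_iff] using congrArg (Polynomial.eval 0) hu
  have h2 : u 2 = 0 := by
    simpa [h01, Complex.ext_iff] using congrArg (Polynomial.eval 1) hu
  ext i
  fin_cases i
  exacts [h01.1, h01.2, h2]

theorem isAntipodal_realConeQuad (u : Fin 3 → ℝ) : IsAntipodal 1 (realConeQuad u) := by
  have h := isAntipodal_restrictCone_map (isHomogeneous_linForm u)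
  rwa [map_linForm, restrictCone_linForm, coneQuad_algebraMap_comp] at h

/-- The real vector whose quadratic polynomial `coneQuad` has the roots `r` and `-1 / conj r`. -/
def rootVec (r : ℂ) : Fin 3 → ℝ :=
  ![-2 * r.re, 2 * r.im, 1 - Complex.normSq r]

theorem realConeQuad_rootVec (r : ℂ) : realConeQuad (rootVec r) =
    (Polynomial.X - Polynomial.C r) * (Polynomial.C (conj r) * Polynomial.X + 1) := by
  have h1 : ((rootVec r 0 : ℂ) - I * rootVec r 1) / 2 = -r := by
    apply Complex.ext <;> simp [rootVec] <;> ring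
  have h2 : ((rootVec r 0 : ℂ) + I * rootVec r 1) / 2 = -conj r := by
    apply Complex.ext <;> simp [rootVec]
    ring
  have h3 : (rootVec r 2 : ℂ) = 1 - r * conj r := by
    rw [Complex.mul_conj]
    simp [rootVec]
  rw [← coneQuad_algebraMap_comp, coneQuad_eq]
  simp only [Function.comp_apply, Complex.coe_algebraMap, h1, h2, h3, map_neg, map_sub, map_mul,
    map_one]
  ring

theorem rootVec_ne_zero (r : ℂ) : rootVec r ≠ 0 := fun h => by
  have h0 : r = 0 := Complex.ext (by simpa [rootVec] using congrFun h 0)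
    (by simpa [rootVec] using congrFun h 1)
  have h2 : 1 - Complex.normSq r = 0 := congrFun h 2
  rw [h0, map_zero, sub_zero] at h2
  exact one_ne_zero h2

theorem IsAntipodal.realConeQuad_rootVec_dvd {n : ℕ} {f : Polynomial ℂ} (hf : IsAntipodal n f)
    {r : ℂ} (hr : f.IsRoot r) : realConeQuad (rootVec r) ∣ f := by
  rw [realConeQuad_rootVec]
  refine IsCoprime.mul_dvd ?_ (Polynomial.dvd_iff_isRoot.2 hr) (hf.dvd_of_isRoot hr)
  have hpos : 1 + r * conj r ≠ 0 := by
    rw [Complex.mul_conj]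
    exact_mod_cast (add_pos_of_pos_of_nonneg one_pos (Complex.normSq_nonneg r)).ne'
  have hC : Polynomial.C (1 + r * conj r) * Polynomial.C (1 + r * conj r)⁻¹ = 1 := by
    rw [← map_mul, mul_inv_cancel₀ hpos, map_one]
  refine ⟨-(Polynomial.C (conj r) * Polynomial.C (1 + r * conj r)⁻¹),
    Polynomial.C (1 + r * conj r)⁻¹, ?_⟩
  refine Eq.trans ?_ hC
  simp only [map_add, map_mul, map_one]
  ring

theorem IsAntipodal.exists_eq_realConeQuad_mul {n : ℕ} {f : Polynomial ℂ}
    (hf : IsAntipodal (n + 1) f) : ∃ u g, f = realConeQuad u * g ∧ IsAntipodal n g := by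
  rcases eq_or_ne f 0 with rfl | hf0
  · exact ⟨0, 0, by simp, by simp [IsAntipodal]⟩
  obtain ⟨r, hr⟩ := hf.exists_isRoot hf0
  obtain ⟨g, rfl⟩ := hf.realConeQuad_rootVec_dvd hr
  rw [add_comm] at hf
  exact ⟨_, g, rfl, (isAntipodal_realConeQuad _).of_mul hf (left_ne_zero_of_mul hf0)⟩

theorem IsAntipodal.exists_eq_prod_realConeQuad {n : ℕ} {f : Polynomial ℂ}
    (hf : IsAntipodal (n + 1) f) : ∃ u : Fin (n + 1) → Fin 3 → ℝ, f = ∏ j, realConeQuad (u j) := by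
  induction n generalizing f with
  | zero =>
    obtain ⟨v, g, rfl, hg⟩ := hf.exists_eq_realConeQuad_mul
    obtain ⟨a, rfl⟩ := hg.exists_eq_C
    exact ⟨fun _ => a • v, by rw [Fin.prod_univ_one, map_smul, mul_comm, C_ofReal_mul]⟩
  | succ n ih =>
    obtain ⟨v, g, rfl, hg⟩ := hf.exists_eq_realConeQuad_mul
    obtain ⟨u, rfl⟩ := ih hg
    exact ⟨Fin.cons v u, by simp [Fin.prod_univ_succ (n := n + 1)]⟩

theorem exists_eq_smul_rootVec {u : Fin 3 → ℝ} {r : ℂ} (hr : (realConeQuad u).IsRoot r) :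
    ∃ a : ℝ, u = a • rootVec r := by
  obtain ⟨g, hg⟩ := (isAntipodal_realConeQuad u).realConeQuad_rootVec_dvd hr
  have hne := (map_ne_zero_iff _ realConeQuad_injective).2 (rootVec_ne_zero r)
  obtain ⟨a, rfl⟩ := ((isAntipodal_realConeQuad (rootVec r)).of_mul (n := 0)
    (hg ▸ isAntipodal_realConeQuad u) hne).exists_eq_C
  refine ⟨a, realConeQuad_injective ?_⟩
  rw [hg, map_smul, mul_comm, C_ofReal_mul]

theorem exists_perm_of_prod_realConeQuad_eq {n : ℕ} {u u' : Fin n → Fin 3 → ℝ} {c : ℝ} (hc : c ≠ 0)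
    (hu : ∀ j, u j ≠ 0) (hu' : ∀ j, u' j ≠ 0)
    (h : ∏ j, realConeQuad (u j) = c • ∏ j, realConeQuad (u' j)) :
    ∃ (σ : Equiv.Perm (Fin n)) (t : Fin n → ℝ), ∀ j, u' j = t j • u (σ j) := by
  have hne {v : Fin 3 → ℝ} (hv : v ≠ 0) : realConeQuad v ≠ 0 :=
    (map_ne_zero_iff _ realConeQuad_injective).2 hv
  induction n generalizing c with
  | zero => exact ⟨1, 1, fun j => j.elim0⟩
  | succ n ih =>
    obtain ⟨r, hr⟩ := (isAntipodal_realConeQuad (u 0)).exists_isRoot (n := 0) (hne (hu 0))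
    obtain ⟨i, hi⟩ : ∃ i, (realConeQuad (u' i)).IsRoot r := by
      have h0 := congrArg (Polynomial.eval r) h
      rw [Fin.prod_univ_succ, Polynomial.eval_mul, hr, zero_mul, Polynomial.eval_smul, eq_comm,
        smul_eq_zero_iff_right hc, Polynomial.eval_prod, Finset.prod_eq_zero_iff] at h0
      exact h0.imp fun i hi => hi.2
    obtain ⟨a, ha⟩ := exists_eq_smul_rootVec hr
    obtain ⟨b, hb⟩ := exists_eq_smul_rootVec hi
    have ha0 : a ≠ 0 := fun h0 => hu 0 (by rw [ha, h0, zero_smul])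
    have hb0 : b ≠ 0 := fun h0 => hu' i (by rw [hb, h0, zero_smul])
    have hab : u' i = (b / a) • u 0 := by
      rw [ha, hb, smul_smul, div_mul_cancel₀ _ ha0]
    rw [Fin.prod_univ_succ, Fin.prod_univ_succAbove _ i, hab, map_smul, smul_mul_assoc, smul_smul,
      ← mul_smul_comm] at h
    obtain ⟨σ, t, hσ⟩ := ih (mul_ne_zero hc (div_ne_zero hb0 ha0)) (fun j => hu j.succ)
      (fun j => hu' (i.succAbove j)) (mul_left_cancel₀ (hne (hu 0)) h)
    refine ⟨(finSuccEquiv' i).trans ((Equiv.optionCongr σ).trans (finSuccEquiv' 0).symm),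
      i.insertNth (b / a) t, fun j => ?_⟩
    rcases Fin.eq_self_or_eq_succAbove i j with rfl | ⟨k, rfl⟩
    · simpa using hab
    · simpa using hσ k

theorem sameMultipole_of_prod_realConeQuad_eq {n : ℕ} {u u' : Fin n → Fin 3 → ℝ}
    (h : ∏ j, realConeQuad (u j) = ∏ j, realConeQuad (u' j)) : SameMultipole u u' := by
  have hzero (w : Fin n → Fin 3 → ℝ) : ∏ j, realConeQuad (w j) = 0 ↔ ∃ j, w j = 0 := by
    simp only [Finset.prod_eq_zero_iff, Finset.mem_univ, true_and,
      map_eq_zero_iff _ realConeQuad_injective]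
  by_cases h0 : ∏ j, realConeQuad (u j) = 0
  · exact Or.inl ⟨(hzero u).1 h0, (hzero u').1 (h ▸ h0)⟩
  obtain ⟨σ, t, ht⟩ := exists_perm_of_prod_realConeQuad_eq one_ne_zero
    (not_exists.1 (mt (hzero u).2 h0)) (not_exists.1 (mt (hzero u').2 (h ▸ h0)))
    (h.trans (one_smul ℝ _).symm)
  refine Or.inr ⟨σ, t, ?_, ht⟩
  simp only [ht, map_smul, Finset.prod_smul] at h
  rw [Equiv.prod_comp σ fun j => realConeQuad (u j)] at h
  exact smul_left_injective ℝ h0 (h.symm.trans (one_smul ℝ _).symm)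

end RealStructure

section RealMultipoles

theorem map_subst {R S ι : Type*} [CommRing R] [CommRing S] [Fintype ι] (f : R →+* S)
    (U : Matrix ι ι R) (P : MvPolynomial ι R) :
    MvPolynomial.map f (subst U P) = subst (U.map f) (MvPolynomial.map f P) := by
  induction P using MvPolynomial.induction_on with
  | C a => simp only [algHom_C, algebraMap_eq, map_C]
  | add P T hP hT => simp only [map_add, hP, hT]
  | mul_X P j hP => simp only [map_mul, hP, subst_X, map_X, map_linForm]; rfl

variable {A B : Matrix (Fin 3) (Fin 3) ℝ}

theorem map_subst_inv (hA : A * Aᵀ = B) (hdet : IsUnit B.det) (P : MvPolynomial (Fin 3) ℝ) :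
    MvPolynomial.map (algebraMap ℝ ℂ) (subst A⁻¹ P) =
      subst (A.map (algebraMap ℝ ℂ))⁻¹ (MvPolynomial.map (algebraMap ℝ ℂ) P) := by
  have hinv : (A.map (algebraMap ℝ ℂ))⁻¹ = A⁻¹.map (algebraMap ℝ ℂ) := Matrix.inv_eq_left_inv (by
    rw [← Matrix.map_mul, Matrix.nonsing_inv_mul _ (isUnit_det_of_mul_transpose_eq hA hdet),
      Matrix.map_one _ (map_zero _) (map_one _)])
  rw [map_subst, hinv]

theorem map_mul_transpose_eq (hA : A * Aᵀ = B) :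
    A.map (algebraMap ℝ ℂ) * (A.map (algebraMap ℝ ℂ))ᵀ = B.map (algebraMap ℝ ℂ) := by
  rw [← hA, ← Matrix.transpose_map, ← Matrix.map_mul]

theorem restrictCone_map_subst_maxwellPoly (hA : A * Aᵀ = B) (hdet : IsUnit B.det) {n : ℕ}
    (u : Fin n → Fin 3 → ℝ) :
    restrictCone (MvPolynomial.map (algebraMap ℝ ℂ) (subst A⁻¹ (maxwellPoly B (List.ofFn u)))) =
      maxwellCoeff ℝ 3 n • ∏ j, realConeQuad (u j ᵥ* A) := by
  rw [map_subst_inv hA hdet, map_maxwellPoly, List.map_ofFn, restrictCone_subst_maxwellPoly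
    (map_mul_transpose_eq hA) (isUnit_det_map _ hdet), ← C_ofReal_mul]
  congr 1
  · simp [maxwellCoeff]
  · refine Finset.prod_congr rfl fun j _ => ?_
    rw [← coneQuad_algebraMap_comp, Function.comp_apply]
    exact congrArg coneQuad (_root_.funext fun i => ((algebraMap ℝ ℂ).map_vecMul A (u j) i).symm)

theorem eq_of_restrictCone_map_subst_eq (hA : A * Aᵀ = B) (hdet : IsUnit B.det) {n : ℕ}
    {P T : MvPolynomial (Fin 3) ℝ} (hP : P ∈ harmonic B n) (hT : T ∈ harmonic B n)
    (h : restrictCone (MvPolynomial.map (algebraMap ℝ ℂ) (subst A⁻¹ P)) =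
      restrictCone (MvPolynomial.map (algebraMap ℝ ℂ) (subst A⁻¹ T))) : P = T := by
  rw [map_subst_inv hA hdet, map_subst_inv hA hdet] at h
  exact map_injective _ (algebraMap ℝ ℂ).injective (eq_of_restrictCone_subst_eq
    (map_mul_transpose_eq hA) (isUnit_det_map _ hdet) (map_mem_harmonic _ hdet hP)
    (map_mem_harmonic _ hdet hT) h)

theorem exists_eq_maxwellPoly_real (hA : A * Aᵀ = B) (hdet : IsUnit B.det) {n : ℕ}
    {H : MvPolynomial (Fin 3) ℝ} (hH : H ∈ harmonic B (n + 1)) :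
    ∃ u : Fin (n + 1) → Fin 3 → ℝ, H = maxwellPoly B (List.ofFn u) := by
  have hκ : maxwellCoeff ℝ 3 (n + 1) ≠ 0 := maxwellCoeff_ne_zero (by norm_num) _
  obtain ⟨w, hw⟩ := (isAntipodal_restrictCone_map (isHomogeneous_subst A⁻¹
    (Submodule.smul_mem _ (maxwellCoeff ℝ 3 (n + 1))⁻¹ hH).1)).exists_eq_prod_realConeQuad
  have hM := maxwellPoly_mem_harmonic (hA ▸ Matrix.isSymm_mul_transpose_self A) hdet
    (List.ofFn fun j => w j ᵥ* A⁻¹)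
  rw [List.length_ofFn] at hM
  refine ⟨fun j => w j ᵥ* A⁻¹, eq_of_restrictCone_map_subst_eq hA hdet hH hM ?_⟩
  rw [restrictCone_map_subst_maxwellPoly hA hdet]
  simp only [Matrix.vecMul_vecMul, Matrix.vecMul_one,
    Matrix.nonsing_inv_mul _ (isUnit_det_of_mul_transpose_eq hA hdet)]
  rw [← hw, ← C_ofReal_mul, ← restrictCone_C, ← map_mul, ← Complex.coe_algebraMap, ← map_C,
    ← map_mul, ← algebraMap_eq, ← algHom_C (subst A⁻¹), ← map_mul, ← smul_eq_C_mul,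
    smul_inv_smul₀ hκ]

theorem sameMultipole_of_maxwellPoly_eq (hA : A * Aᵀ = B) (hdet : IsUnit B.det) {n : ℕ}
    {u u' : Fin n → Fin 3 → ℝ}
    (h : maxwellPoly B (List.ofFn u) = maxwellPoly B (List.ofFn u')) : SameMultipole u u' := by
  have hinj : Function.Injective (· ᵥ* A) :=
    Matrix.vecMul_injective_of_isUnit ((Matrix.isUnit_iff_isUnit_det A).2
      (isUnit_det_of_mul_transpose_eq hA hdet))
  have hprod := congrArg (fun P => restrictCone (MvPolynomial.map (algebraMap ℝ ℂ) (subst A⁻¹ P))) h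
  simp only [restrictCone_map_subst_maxwellPoly hA hdet] at hprod
  rcases sameMultipole_of_prod_realConeQuad_eq (smul_right_injective _
    (maxwellCoeff_ne_zero (by norm_num) n) hprod) with ⟨⟨j, hj⟩, ⟨j', hj'⟩⟩ | ⟨σ, t, ht, hσ⟩
  · exact Or.inl ⟨⟨j, hinj (hj.trans (Matrix.zero_vecMul A).symm)⟩,
      ⟨j', hinj (hj'.trans (Matrix.zero_vecMul A).symm)⟩⟩
  · exact Or.inr ⟨σ, t, ht, fun j => hinj ((hσ j).trans (Matrix.smul_vecMul _ _ _).symm)⟩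

end RealMultipoles

section Representation

variable {ι R : Type*} [Fintype ι] [CommRing R]

theorem maxwellPoly_eq_one (B : Matrix ι ι R) {us : List (ι → R)} (hus : us.length = 0) :
    maxwellPoly B us = 1 := by
  rw [List.length_eq_zero_iff.1 hus, maxwellPoly]

theorem C_mul_maxwellPoly_mem_harmonic [DecidableEq ι] {B : Matrix ι ι R} (hB : B.IsSymm)
    (hdet : IsUnit B.det) {n : ℕ} (c : R) (u : Fin n → ι → R) :
    C c * maxwellPoly B (List.ofFn u) ∈ harmonic B n := by
  have hu := maxwellPoly_mem_harmonic hB hdet (List.ofFn u)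
  rw [List.length_ofFn] at hu
  rw [← smul_eq_C_mul]
  exact Submodule.smul_mem _ c hu

variable {K : Type*} [DecidableEq ι] [Nonempty ι] [Field K] [CharZero K] {B : Matrix ι ι K} {d : ℕ}

theorem exists_map_eq_maxwellSumPoly (hB : B.IsSymm) (hdet : IsUnit B.det) (f : K →+* R)
    (hf : ∀ n, ∀ H ∈ harmonic B (n + 1), ∃ u : Fin (n + 1) → ι → R,
      map f H = maxwellPoly (B.map f) (List.ofFn u))
    {P : MvPolynomial ι K} (hP : P.IsHomogeneous d) :
    ∃ (u : (k : ℕ) → Fin (d - 2 * k) → ι → R) (lam : K),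
      map f P = maxwellSumPoly (B.map f) d u (f lam) := by
  obtain ⟨H, hH, rfl⟩ := exists_harmonic_decomposition hB hdet hP
  have hex (k : ℕ) : ∃ u : Fin (d - 2 * k) → ι → R,
      2 * k < d → map f (H k) = maxwellPoly (B.map f) (List.ofFn u) := by
    rcases lt_or_ge (2 * k) d with hk | hk
    · have hk' := hH k hk.le
      obtain ⟨n, hn⟩ := Nat.exists_eq_add_of_lt hk
      rw [show d - 2 * k = n + 1 by omega] at hk' ⊢
      exact (hf n _ hk').imp fun u hu _ => hu
    · exact ⟨0, fun h => absurd h hk.not_gt⟩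
  choose u hu using hex
  refine ⟨u, coeff 0 (H (d / 2)), ?_⟩
  rw [maxwellSumPoly, map_sum]
  refine Finset.sum_congr rfl fun k hk => ?_
  rw [Finset.mem_range] at hk
  rw [map_mul, map_pow, map_quadForm]
  split_ifs with hkd
  · have hconst := (mem_harmonic.1 (hH k hkd.le)).1
    rw [hkd, Nat.sub_self, ← totalDegree_zero_iff_isHomogeneous,
      totalDegree_eq_zero_iff_eq_C] at hconst
    rw [maxwellPoly_eq_one _ (by rw [List.length_ofFn]; omega), mul_one, ← map_C,
      show d / 2 = k by omega, ← hconst]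
  · rw [hu k (by omega), C_1, one_mul]

theorem maxwellPoly_eq_of_maxwellSumPoly_eq (hB : B.IsSymm) (hdet : IsUnit B.det)
    {u u' : (k : ℕ) → Fin (d - 2 * k) → ι → K} {lam lam' : K}
    (h : maxwellSumPoly B d u lam = maxwellSumPoly B d u' lam') :
    (∀ k, 2 * k < d → maxwellPoly B (List.ofFn (u k)) = maxwellPoly B (List.ofFn (u' k))) ∧
      (Even d → lam = lam') := by
  have key (k : ℕ) (hk : 2 * k ≤ d) := eq_of_sum_quadForm_pow_mul_eq hB hdet
    (fun k _ => C_mul_maxwellPoly_mem_harmonic hB hdet _ (u k))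
    (fun k _ => C_mul_maxwellPoly_mem_harmonic hB hdet _ (u' k)) h hk
  refine ⟨fun k hk => ?_, ?_⟩
  · simpa only [if_neg hk.ne, C_1, one_mul] using key k hk.le
  · rintro ⟨k, rfl⟩
    have hk := key k (by omega)
    rw [if_pos (two_mul k), if_pos (two_mul k), maxwellPoly_eq_one _ (by simp [two_mul]),
      maxwellPoly_eq_one _ (by simp [two_mul]), mul_one, mul_one] at hk
    exact C_injective _ _ hk

end Representation

section MaxwellRep

variable {B : Matrix (Fin 3) (Fin 3) ℝ} {d : ℕ} {P : MvPolynomial (Fin 3) ℝ} {lam : ℝ}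

theorem maxwellRep_of_map_eq (hB : B.IsSymm) {u : (k : ℕ) → Fin (d - 2 * k) → Fin 3 → ℂ}
    (h : map (algebraMap ℝ ℂ) P = maxwellSumPoly (B.map (algebraMap ℝ ℂ)) d u lam) :
    MaxwellRep B d P u lam := by
  intro W s hs v hv
  rw [hs.maxwellSum_eq hB d u lam hv, ← h]
  exact (congrArg Complex.re (eval_comp_map (algebraMap ℝ ℂ) v P)).symm

theorem maxwellRep_ofReal_iff (hB : B.IsSymm) (hdet : IsUnit B.det)
    {u : (k : ℕ) → Fin (d - 2 * k) → Fin 3 → ℝ} :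
    MaxwellRep B d P (fun k j i => (u k j i : ℂ)) lam ↔ P = maxwellSumPoly B d u lam := by
  have hmap := map_maxwellSumPoly (algebraMap ℝ ℂ) B d u lam
  refine ⟨fun h => ?_, fun h => maxwellRep_of_map_eq hB (h ▸ hmap)⟩
  refine mul_right_cancel₀ (quadForm_ne_zero hB hdet) (MvPolynomial.funext fun v => ?_)
  rw [map_mul, map_mul]
  by_cases hv : eval v (quadForm B) = 0
  · rw [hv, mul_zero, mul_zero]
  have hvc : aeval (fun i => (v i : ℂ)) (quadPoly B) ≠ 0 := by
    rw [aeval_def, eval₂_eq_eval_map]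
    exact (eval_comp_map (algebraMap ℝ ℂ) v (quadForm B)).trans_ne (Complex.ofReal_ne_zero.2 hv)
  obtain ⟨W, s, hW, hs⟩ := exists_isSqrtBranch B _ hvc
  rw [h W s hs v hW, hs.maxwellSum_eq hB d _ lam hW]
  have hre := congrArg Complex.re (eval_comp_map (algebraMap ℝ ℂ) v (maxwellSumPoly B d u lam))
  rw [hmap] at hre
  exact congrArg (· * _) hre

theorem exists_maxwellRep (hB : B.IsSymm) (hdet : IsUnit B.det) (hP : P.IsHomogeneous d) :
    ∃ (u : (k : ℕ) → Fin (d - 2 * k) → Fin 3 → ℂ) (lam : ℝ), MaxwellRep B d P u lam := by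
  obtain ⟨A, hA⟩ := exists_mul_transpose_eq_map hB
  obtain ⟨u, lam, h⟩ := exists_map_eq_maxwellSumPoly hB hdet (algebraMap ℝ ℂ)
    (fun n H hH => exists_eq_maxwellPoly hA (isUnit_det_map _ hdet) (map_mem_harmonic _ hdet hH)) hP
  exact ⟨u, lam, maxwellRep_of_map_eq hB h⟩

theorem exists_maxwellRep_ofReal (hB : B.PosDef) (hP : P.IsHomogeneous d) :
    ∃ (u : (k : ℕ) → Fin (d - 2 * k) → Fin 3 → ℝ) (lam : ℝ),
      MaxwellRep B d P (fun k j i => (u k j i : ℂ)) lam := by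
  have hdet : IsUnit B.det := hB.det_pos.ne'.isUnit
  obtain ⟨A, hA⟩ := exists_mul_transpose_eq_of_posDef hB
  have hsymm : B.IsSymm := hA ▸ Matrix.isSymm_mul_transpose_self A
  obtain ⟨u, lam, h⟩ := exists_map_eq_maxwellSumPoly hsymm hdet (RingHom.id ℝ)
    (fun n H hH => by
      rw [map_id, RingHom.coe_id, Matrix.map_id]
      exact exists_eq_maxwellPoly_real hA hdet hH) hP
  rw [map_id, RingHom.coe_id, Matrix.map_id] at h
  exact ⟨u, lam, (maxwellRep_ofReal_iff hsymm hdet).2 h⟩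

theorem sameMultipole_of_maxwellRep (hB : B.PosDef) {u u' : (k : ℕ) → Fin (d - 2 * k) → Fin 3 → ℝ}
    {lam' : ℝ} (h : MaxwellRep B d P (fun k j i => (u k j i : ℂ)) lam)
    (h' : MaxwellRep B d P (fun k j i => (u' k j i : ℂ)) lam') :
    (∀ k, 2 * k < d → SameMultipole (u k) (u' k)) ∧ (Even d → lam = lam') := by
  have hdet : IsUnit B.det := hB.det_pos.ne'.isUnit
  obtain ⟨A, hA⟩ := exists_mul_transpose_eq_of_posDef hB
  have hsymm : B.IsSymm := hA ▸ Matrix.isSymm_mul_transpose_self A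
  rw [maxwellRep_ofReal_iff hsymm hdet] at h h'
  exact (maxwellPoly_eq_of_maxwellSumPoly_eq hsymm hdet (h.symm.trans h')).imp_left
    fun hM k hk => sameMultipole_of_maxwellPoly_eq hA hdet (hM k hk)

end MaxwellRep

section GaussianWeight

open Module

variable {E : Type*} [NormedAddCommGroup E] [NormedSpace ℝ E] [FiniteDimensional ℝ E]
  [MeasurableSpace E] [BorelSpace E] (μ : Measure E) [μ.IsAddHaarMeasure] [Nontrivial E]

theorem integrable_exp_neg_sq_norm_mul_norm_pow (n : ℕ) :
    Integrable (fun x => Real.exp (-‖x‖ ^ 2 / 2) * ‖x‖ ^ n) μ := by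
  rw [integrable_fun_norm_addHaar μ (f := fun r => Real.exp (-r ^ 2 / 2) * r ^ n)]
  have h : IntegrableOn (fun r : ℝ => r ^ ((finrank ℝ E - 1 + n : ℕ) : ℝ) *
      Real.exp (-(1 / 2) * r ^ 2)) (Set.Ioi 0) :=
    integrableOn_rpow_mul_exp_neg_mul_sq one_half_pos
      (lt_of_lt_of_le neg_one_lt_zero (Nat.cast_nonneg _))
  refine h.congr_fun (fun r _ => ?_) measurableSet_Ioi
  simp only [Real.rpow_natCast, smul_eq_mul]
  rw [pow_add, show -r ^ 2 / 2 = -(1 / 2) * r ^ 2 by ring]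
  ring

variable {F : Type*} [NormedAddCommGroup F] [NormedSpace ℝ F]

theorem integral_exp_neg_sq_norm_smul {f : E → F} {n : ℕ}
    (hf : ∀ r : ℝ, 0 < r → ∀ x, f (r • x) = r ^ n • f x) :
    ∫ x, Real.exp (-‖x‖ ^ 2 / 2) • f x ∂μ =
      (∫ r : Set.Ioi (0 : ℝ), Real.exp (-(r : ℝ) ^ 2 / 2) * (r : ℝ) ^ n
        ∂Measure.volumeIoiPow (finrank ℝ E - 1)) •
      ∫ v : Metric.sphere (0 : E) 1, f v ∂μ.toSphere := by
  have hpunctured := integral_subtype_comap (μ := μ) (measurableSet_singleton (0 : E)).compl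
    fun x => Real.exp (-‖x‖ ^ 2 / 2) • f x
  rw [restrict_compl_singleton] at hpunctured
  rw [← integral_prod_smul, ← integral_prod_swap, ← hpunctured,
    ← μ.measurePreserving_homeomorphUnitSphereProd.integral_comp
      (Homeomorph.measurableEmbedding _)]
  refine integral_congr_ae (Filter.Eventually.of_forall fun x => ?_)
  have hx : 0 < ‖(x : E)‖ := norm_pos_iff.2 x.2
  simp only [Prod.fst_swap, Prod.snd_swap, homeomorphUnitSphereProd_apply_fst_coe,
    homeomorphUnitSphereProd_apply_snd_coe]
  rw [mul_smul, ← hf _ hx, smul_inv_smul₀ hx.ne']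

theorem integral_toSphere_eq_zero {f : E → F} {n : ℕ}
    (hf : ∀ r : ℝ, 0 < r → ∀ x, f (r • x) = r ^ n • f x)
    (h : ∫ x, Real.exp (-‖x‖ ^ 2 / 2) • f x ∂μ = 0) :
    ∫ v : Metric.sphere (0 : E) 1, f v ∂μ.toSphere = 0 := by
  have hpos : 0 < ∫ x, Real.exp (-‖x‖ ^ 2 / 2) * ‖x‖ ^ n ∂μ := by
    rw [integral_pos_iff_support_of_nonneg (fun x => by positivity)
      (integrable_exp_neg_sq_norm_mul_norm_pow μ n)]
    refine (isOpen_compl_singleton.measure_pos μ (exists_ne (0 : E))).trans_le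
      (measure_mono fun x hx => ?_)
    exact mul_ne_zero (Real.exp_ne_zero _) (pow_ne_zero n (norm_ne_zero_iff.2 hx))
  rw [integral_exp_neg_sq_norm_smul μ hf] at h
  refine (smul_eq_zero.1 h).resolve_left fun hrad => hpos.ne' ?_
  have hnorm := integral_exp_neg_sq_norm_smul μ (f := fun x : E => ‖x‖ ^ n) (n := n)
    fun r hr x => by rw [norm_smul, Real.norm_of_nonneg hr.le, mul_pow, smul_eq_mul]
  rwa [hrad, zero_smul] at hnorm

end GaussianWeight

section GaussianIntegral

theorem hasFDerivAt_exp_neg_sq_norm {E : Type*} [NormedAddCommGroup E] [InnerProductSpace ℝ E]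
    (x : E) :
    HasFDerivAt (fun y : E => Real.exp (-‖y‖ ^ 2 / 2))
      (-Real.exp (-‖x‖ ^ 2 / 2) • innerSL ℝ x) x := by
  have h := ((hasStrictFDerivAt_norm_sq x).hasFDerivAt.const_mul (-1 / 2 : ℝ)).exp
  rw [two_smul, ← two_smul ℝ, smul_smul, smul_smul] at h
  refine (h.congr_fderiv ?_).congr_of_eventuallyEq (Filter.Eventually.of_forall fun y => ?_)
  · congr 1
    ring_nf
  · ring_nf

variable {ι : Type*}

/-- The inclusion of a Euclidean space `ℝ^ι` into `ℂ^ι`. -/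
def ofRealVec : EuclideanSpace ℝ ι →L[ℝ] ι → ℂ :=
  ContinuousLinearMap.pi fun i => Complex.ofRealCLM ∘L EuclideanSpace.proj i

theorem ofRealVec_apply (x : EuclideanSpace ℝ ι) (i : ι) : ofRealVec x i = x i := rfl

theorem eval_ofRealVec_map_conj (x : EuclideanSpace ℝ ι) (P : MvPolynomial ι ℂ) :
    eval (ofRealVec x) (map (starRingEnd ℂ) P) = conj (eval (ofRealVec x) P) := by
  rw [← eval_comp_map]
  congr 2
  exact _root_.funext fun i => (Complex.conj_ofReal (x i)).symm

theorem eval_ofRealVec_smul {P : MvPolynomial ι ℂ} {n : ℕ} (hP : P.IsHomogeneous n) (r : ℝ)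
    (x : EuclideanSpace ℝ ι) :
    eval (ofRealVec (r • x)) P = r ^ n • eval (ofRealVec x) P := by
  rw [map_smul, Complex.real_smul, Complex.ofReal_pow]
  exact eval₂_mul_of_isHomogeneous hP (RingHom.id ℂ) r (ofRealVec x)

theorem hasFDerivAt_eval_ofRealVec [Finite ι] (P : MvPolynomial ι ℂ)
    (x : EuclideanSpace ℝ ι) :
    HasFDerivAt (fun y => eval (ofRealVec y) P)
      ((fderiv ℂ (fun z => eval z P) (ofRealVec x)).restrictScalars ℝ ∘L ofRealVec) x := by
  have := Fintype.ofFinite ι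
  exact ((differentiableAt_eval P _).hasFDerivAt.restrictScalars ℝ).comp x ofRealVec.hasFDerivAt

theorem fderiv_eval_ofRealVec_single [Finite ι] [DecidableEq ι]
    (P : MvPolynomial ι ℂ) (x : EuclideanSpace ℝ ι) (i : ι) :
    fderiv ℝ (fun y => eval (ofRealVec y) P) x (EuclideanSpace.single i 1) =
      eval (ofRealVec x) (pderiv i P) := by
  have := Fintype.ofFinite ι
  have hi : ofRealVec (EuclideanSpace.single i (1 : ℝ)) = Pi.single i 1 := by
    ext j
    rw [ofRealVec_apply, PiLp.single_apply, Pi.single_apply]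
    split_ifs <;> simp
  rw [(hasFDerivAt_eval_ofRealVec P x).fderiv, ← dirDeriv_single_one, ← hi]
  exact fderiv_eval P _ _

variable [Fintype ι]

theorem eval_ofRealVec_quadForm_one [DecidableEq ι] {x : EuclideanSpace ℝ ι} (hx : ‖x‖ = 1) :
    eval (ofRealVec x) (quadForm (1 : Matrix ι ι ℂ)) = 1 := by
  have h := EuclideanSpace.real_norm_sq_eq x
  rw [eval_quadForm, Matrix.vecMul_one, dotProduct]
  simp only [ofRealVec_apply, ← pow_two]
  exact_mod_cast h.symm.trans (by rw [hx, one_pow])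

variable [Nonempty ι]

theorem integrable_exp_neg_sq_norm_smul_eval (P : MvPolynomial ι ℂ) :
    Integrable fun x : EuclideanSpace ℝ ι =>
      Real.exp (-‖x‖ ^ 2 / 2) • eval (ofRealVec x) P := by
  induction P using MvPolynomial.induction_on' with
  | monomial s a =>
    refine ((integrable_exp_neg_sq_norm_mul_norm_pow volume (∑ i, s i)).const_mul ‖a‖).mono'
      (Continuous.aestronglyMeasurable ?_) (Filter.Eventually.of_forall fun x => ?_)
    · exact Continuous.smul (f := fun x => Real.exp (-‖x‖ ^ 2 / 2)) (by fun_prop)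
        ((MvPolynomial.continuous_eval _).comp ofRealVec.continuous)
    · rw [norm_smul, Real.norm_of_nonneg (Real.exp_pos _).le, eval_monomial, norm_mul,
        mul_left_comm, Finsupp.prod_fintype _ _ (by simp), norm_prod,
        ← Finset.prod_pow_eq_pow_sum]
      gcongr with i
      rw [norm_pow, ofRealVec_apply, Complex.norm_real]
      gcongr
      exact PiLp.norm_apply_le x i
  | add p q hp hq =>
    simp only [map_add, smul_add]
    exact hp.add hq

/-- The integral of a complex polynomial over `ℝ^ι` against the unnormalised Gaussian weight. -/
def gaussianIntegral : MvPolynomial ι ℂ →ₗ[ℂ] ℂ where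
  toFun P := ∫ x : EuclideanSpace ℝ ι, Real.exp (-‖x‖ ^ 2 / 2) • eval (ofRealVec x) P
  map_add' P T := by
    simp only [map_add, smul_add]
    exact integral_add (integrable_exp_neg_sq_norm_smul_eval P)
      (integrable_exp_neg_sq_norm_smul_eval T)
  map_smul' a P := by
    simp only [smul_eval, ← mul_smul_comm, RingHom.id_apply, smul_eq_mul]
    exact integral_const_mul a _

theorem gaussianIntegral_pderiv (i : ι) (P : MvPolynomial ι ℂ) :
    gaussianIntegral (pderiv i P) = gaussianIntegral (X i * P) := by
  classical
  set e : EuclideanSpace ℝ ι := EuclideanSpace.single i 1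
  have hexp (x : EuclideanSpace ℝ ι) : fderiv ℝ (fun y => Real.exp (-‖y‖ ^ 2 / 2)) x e •
      eval (ofRealVec x) P = -(Real.exp (-‖x‖ ^ 2 / 2) • eval (ofRealVec x) (X i * P)) := by
    rw [(hasFDerivAt_exp_neg_sq_norm x).fderiv]
    simp [e, EuclideanSpace.inner_single_right, ofRealVec_apply, mul_assoc]
  have hparts := integral_smul_fderiv_eq_neg_fderiv_smul_of_integrable (μ := volume)
    (f := fun x : EuclideanSpace ℝ ι => Real.exp (-‖x‖ ^ 2 / 2))
    (g := fun x => eval (ofRealVec x) P) (v := e)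
    (by simpa only [hexp] using! (integrable_exp_neg_sq_norm_smul_eval (X i * P)).neg)
    (by simpa only [e, fderiv_eval_ofRealVec_single] using integrable_exp_neg_sq_norm_smul_eval _)
    (integrable_exp_neg_sq_norm_smul_eval P)
    (fun x _ => (hasFDerivAt_exp_neg_sq_norm x).differentiableAt)
    (fun x _ => (hasFDerivAt_eval_ofRealVec P x).differentiableAt)
  simpa only [e, fderiv_eval_ofRealVec_single, hexp, integral_neg, neg_neg] using! hparts

end GaussianIntegral

section Green

variable {ι R : Type*} [Fintype ι] [CommRing R]

theorem sum_X_mul_mul_pderiv_sub {H G : MvPolynomial ι R} {a b : ℕ} (hH : H.IsHomogeneous a)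
    (hG : G.IsHomogeneous b) :
    ∑ i, X i * (H * pderiv i G - G * pderiv i H) = C (b - a : R) * (H * G) :=
  calc ∑ i, X i * (H * pderiv i G - G * pderiv i H)
      = H * ∑ i, X i * pderiv i G - G * ∑ i, X i * pderiv i H := by
        rw [Finset.mul_sum, Finset.mul_sum, ← Finset.sum_sub_distrib]
        exact Finset.sum_congr rfl fun i _ => by ring
    _ = C (b - a : R) * (H * G) := by
        rw [hG.sum_X_mul_pderiv, hH.sum_X_mul_pderiv, map_sub, map_natCast, map_natCast,
          nsmul_eq_mul, nsmul_eq_mul]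
        ring

variable [DecidableEq ι]

theorem laplacian_one_apply (P : MvPolynomial ι R) :
    laplacian 1 P = ∑ i, pderiv i (pderiv i P) := by
  simp [laplacian_apply, dirDeriv_apply, Matrix.row, Matrix.one_apply]

theorem sum_pderiv_mul_pderiv_sub (H G : MvPolynomial ι R) :
    ∑ i, pderiv i (H * pderiv i G - G * pderiv i H) = H * laplacian 1 G - G * laplacian 1 H := by
  rw [laplacian_one_apply, laplacian_one_apply, Finset.mul_sum, Finset.mul_sum,
    ← Finset.sum_sub_distrib]
  refine Finset.sum_congr rfl fun i _ => ?_
  rw [map_sub, pderiv_mul, pderiv_mul]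
  ring

end Green

section Orthogonality

variable {ι : Type*} [Fintype ι] [DecidableEq ι] [Nonempty ι] {a b : ℕ}

theorem gaussianIntegral_mul_eq_zero {H G : MvPolynomial ι ℂ} (hab : a ≠ b)
    (hH : H ∈ harmonic 1 a) (hG : G ∈ harmonic 1 b) : gaussianIntegral (H * G) = 0 := by
  rw [mem_harmonic] at hH hG
  have hgreen := congrArg gaussianIntegral (sum_pderiv_mul_pderiv_sub H G)
  rw [hH.2, hG.2, mul_zero, mul_zero, sub_zero, map_zero, map_sum] at hgreen
  simp only [gaussianIntegral_pderiv] at hgreen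
  rw [← map_sum, sum_X_mul_mul_pderiv_sub hH.1 hG.1, ← smul_eq_C_mul, map_smul] at hgreen
  exact (smul_eq_zero.1 hgreen).resolve_left (sub_ne_zero.2 (Nat.cast_injective.ne hab.symm))

theorem integral_toSphere_eval_mul_eq_zero {H G : MvPolynomial ι ℂ} (hab : a ≠ b)
    (hH : H ∈ harmonic 1 a) (hG : G ∈ harmonic 1 b) :
    ∫ v : Metric.sphere (0 : EuclideanSpace ℝ ι) 1, eval (ofRealVec v) (H * G)
      ∂(volume : Measure (EuclideanSpace ℝ ι)).toSphere = 0 :=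
  integral_toSphere_eq_zero volume
    (fun r _ x => eval_ofRealVec_smul ((mem_harmonic.1 hH).1.mul (mem_harmonic.1 hG).1) r x)
    (gaussianIntegral_mul_eq_zero hab hH hG)

end Orthogonality

section Invariance

variable {ι R : Type*} [Fintype ι] [DecidableEq ι] [CommRing R] {B U : Matrix ι ι R}

theorem subst_mem_harmonic (hU : IsUnit U.det) {P : MvPolynomial ι R} {n : ℕ}
    (hP : P ∈ harmonic B n) : subst U P ∈ harmonic (U * B * Uᵀ) n :=
  mem_harmonic.2 ⟨isHomogeneous_subst U hP.1, by
    rw [laplacian_subst hU, (mem_harmonic.1 hP).2, map_zero]⟩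

theorem subst_mem_harmonicSummand (hU : IsUnit U.det) {P : MvPolynomial ι R} {d k : ℕ}
    (hP : P ∈ harmonicSummand B d k) : subst U P ∈ harmonicSummand (U * B * Uᵀ) d k := by
  obtain ⟨H, hH, rfl⟩ := mem_harmonicSummand.1 hP
  exact mem_harmonicSummand.2
    ⟨subst U H, subst_mem_harmonic hU hH, by rw [map_mul, map_pow, subst_quadForm]⟩

theorem map_subst_harmonicSummand (hU : IsUnit U.det) (hUB : U * B * Uᵀ = B) (d k : ℕ) :
    (harmonicSummand B d k).map (subst U).toLinearMap = harmonicSummand B d k := by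
  refine le_antisymm ?_ fun P hP => ⟨subst U⁻¹ P, ?_, ?_⟩
  · rintro _ ⟨P, hP, rfl⟩
    simpa only [hUB] using! subst_mem_harmonicSummand hU hP
  · have hinv : U⁻¹ * B * U⁻¹ᵀ = B := by
      conv_lhs => rw [← hUB]
      rw [Matrix.mul_assoc U, Matrix.nonsing_inv_mul_cancel_left _ _ hU, Matrix.mul_assoc,
        ← Matrix.transpose_mul, Matrix.nonsing_inv_mul _ hU, Matrix.transpose_one, Matrix.mul_one]
    simpa only [hinv] using!
      subst_mem_harmonicSummand (Matrix.isUnit_nonsing_inv_det _ hU) hP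
  · exact (subst_subst U U⁻¹ P).trans (by rw [Matrix.mul_nonsing_inv _ hU, subst_one])

end Invariance

section SphereInner

variable {A : Matrix (Fin 3) (Fin 3) ℂ} {B : Matrix (Fin 3) (Fin 3) ℝ}

theorem subst_inv_map_mem_harmonic (hdet : IsUnit B.det) (hA : A * Aᵀ = B.map (algebraMap ℝ ℂ))
    {n : ℕ} {H : MvPolynomial (Fin 3) ℝ} (hH : H ∈ harmonic B n) :
    subst A⁻¹ (map (algebraMap ℝ ℂ) H) ∈ harmonic 1 n := by
  have hdetC := isUnit_det_map (algebraMap ℝ ℂ) hdet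
  rw [← inv_mul_mul_transpose_inv_eq_one hA hdetC]
  exact subst_mem_harmonic
    (Matrix.isUnit_nonsing_inv_det _ (isUnit_det_of_mul_transpose_eq hA hdetC))
    (map_mem_harmonic _ hdet hH)

theorem aeval_quadForm_pow_mul (hdet : IsUnit B.det) (hA : A * Aᵀ = B.map (algebraMap ℝ ℂ))
    {v : EuclideanSpace ℝ (Fin 3)} (hv : ‖v‖ = 1) (k : ℕ) (H : MvPolynomial (Fin 3) ℝ) :
    aeval (ofRealVec v ᵥ* A⁻¹) (quadForm B ^ k * H) =
      eval (ofRealVec v) (subst A⁻¹ (map (algebraMap ℝ ℂ) H)) := by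
  rw [aeval_def, ← eval_map, ← eval_subst]
  simp only [map_mul, map_pow, map_quadForm,
    subst_inv_quadForm hA (isUnit_det_map (algebraMap ℝ ℂ) hdet), eval_ofRealVec_quadForm_one hv,
    one_pow, one_mul]

theorem sphereInner_eq_zero (hdet : IsUnit B.det) (hA : A * Aᵀ = B.map (algebraMap ℝ ℂ))
    {d k l : ℕ} (hkl : d - 2 * k ≠ d - 2 * l) {f g : MvPolynomial (Fin 3) ℝ}
    (hf : f ∈ harmonicSummand B d k) (hg : g ∈ harmonicSummand B d l) : sphereInner A f g = 0 := by
  obtain ⟨H, hH, rfl⟩ := mem_harmonicSummand.1 hf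
  obtain ⟨G, hG, rfl⟩ := mem_harmonicSummand.1 hg
  set F := subst A⁻¹ (map (algebraMap ℝ ℂ) H) with hF
  set E := map (starRingEnd ℂ) (subst A⁻¹ (map (algebraMap ℝ ℂ) G)) with hE
  have hEharm : E ∈ harmonic 1 (d - 2 * l) := by
    simpa using map_mem_harmonic (starRingEnd ℂ) (by simp) (subst_inv_map_mem_harmonic hdet hA hG)
  have hint : ∫ v : Metric.sphere (0 : EuclideanSpace ℝ (Fin 3)) 1,
      aeval (ofRealVec v ᵥ* A⁻¹) (quadForm B ^ k * H) *
        conj (aeval (ofRealVec v ᵥ* A⁻¹) (quadForm B ^ l * G)) ∂volume.toSphere = 0 := by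
    have hpt (v : Metric.sphere (0 : EuclideanSpace ℝ (Fin 3)) 1) :=
      aeval_quadForm_pow_mul hdet hA (mem_sphere_zero_iff_norm.1 v.2)
    simp only [hpt, ← hF, ← eval_ofRealVec_map_conj, ← hE, ← map_mul]
    exact integral_toSphere_eval_mul_eq_zero hkl (subst_inv_map_mem_harmonic hdet hA hH) hEharm
  exact congrArg Complex.re hint

end SphereInner

end

end QHarm

theorem theorem17 (B : Matrix (Fin 3) (Fin 3) ℝ) (hB : B.IsSymm) (hdet : B.det ≠ 0) :
    -- the invariant orthogonal decomposition
    (∀ d : ℕ,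
      (iSupIndep fun k : Fin (d / 2 + 1) => QHarm.summand B d k) ∧
      (⨆ k : Fin (d / 2 + 1), QHarm.summand B d k) = homogeneousSubmodule (Fin 3) ℝ d ∧
      (∀ U ∈ QHarm.orthoGroup B, ∀ k : Fin (d / 2 + 1),
        (QHarm.summand B d k).map (QHarm.act (U : Matrix (Fin 3) (Fin 3) ℝ)) =
          QHarm.summand B d k) ∧
      (∀ A : Matrix (Fin 3) (Fin 3) ℂ, A * Aᵀ = B.map (fun x : ℝ => (x : ℂ)) →
        ∀ k l : Fin (d / 2 + 1), k ≠ l →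
          ∀ f ∈ QHarm.summand B d k, ∀ g ∈ QHarm.summand B d l, QHarm.sphereInner A f g = 0)) ∧
    -- polynomial functions on `{Q = c}` are restrictions of `Q`-harmonic polynomials
    (∀ (c : ℝ) (F : MvPolynomial (Fin 3) ℝ), ∃ P : MvPolynomial (Fin 3) ℝ,
      QHarm.lapl B P = 0 ∧
      ∀ v : Fin 3 → ℝ, eval v (QHarm.quadPoly B) = c → eval v P = eval v F) ∧
    -- the Dirichlet problem: existence, and uniqueness if `{Q = c}` is not contained in `{0}`
    (∀ (c : ℝ) (M N : MvPolynomial (Fin 3) ℝ),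
      (∃ P : MvPolynomial (Fin 3) ℝ, QHarm.lapl B P = M ∧
        ∀ v : Fin 3 → ℝ, eval v (QHarm.quadPoly B) = c → eval v P = eval v N) ∧
      ((∃ v : Fin 3 → ℝ, v ≠ 0 ∧ eval v (QHarm.quadPoly B) = c) →
        ∃! P : MvPolynomial (Fin 3) ℝ, QHarm.lapl B P = M ∧
          ∀ v : Fin 3 → ℝ, eval v (QHarm.quadPoly B) = c → eval v P = eval v N)) ∧
    -- the Maxwell-type representation
    (∀ (d : ℕ) (P : MvPolynomial (Fin 3) ℝ), P ∈ homogeneousSubmodule (Fin 3) ℝ d →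
      (∃ (u : (k : ℕ) → Fin (d - 2 * k) → Fin 3 → ℂ) (lam : ℝ), QHarm.MaxwellRep B d P u lam) ∧
      (B.PosDef →
        (∃ (u : (k : ℕ) → Fin (d - 2 * k) → Fin 3 → ℝ) (lam : ℝ),
          QHarm.MaxwellRep B d P (fun k j i => (u k j i : ℂ)) lam) ∧
        (∀ (u u' : (k : ℕ) → Fin (d - 2 * k) → Fin 3 → ℝ) (lam lam' : ℝ),
          QHarm.MaxwellRep B d P (fun k j i => (u k j i : ℂ)) lam →
          QHarm.MaxwellRep B d P (fun k j i => (u' k j i : ℂ)) lam' →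
            (∀ k : ℕ, 2 * k < d → QHarm.SameMultipole (u k) (u' k)) ∧
            (Even d → lam = lam')))) := by
  have hdet' : IsUnit B.det := isUnit_iff_ne_zero.2 hdet
  refine ⟨fun d => ⟨QHarm.iSupIndep_harmonicSummand hB hdet' d,
      QHarm.iSup_harmonicSummand hB hdet' d, fun U hU k => ?invariance,
      fun A hA k l hkl f hf g hg =>
        QHarm.sphereInner_eq_zero hdet' hA (by have := Fin.val_ne_of_ne hkl; omega) hf hg⟩,
    fun c F => QHarm.exists_laplacian_eq_and_eval_eq hB hdet' c 0 F,
    fun c M N => ⟨QHarm.exists_laplacian_eq_and_eval_eq hB hdet' c M N, fun hc => ?uniqueness⟩,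
    fun d P hP => ⟨QHarm.exists_maxwellRep hB hdet' hP, fun hpos =>
      ⟨QHarm.exists_maxwellRep_ofReal hpos hP, fun u u' lam lam' =>
        QHarm.sameMultipole_of_maxwellRep hpos⟩⟩⟩
  case invariance =>
    exact QHarm.map_subst_harmonicSummand ((Matrix.isUnit_iff_isUnit_det _).1 U.isUnit) hU d k
  case uniqueness =>
    obtain ⟨P, hPM, hPN⟩ := QHarm.exists_laplacian_eq_and_eval_eq hB hdet' c M N
    exact ⟨P, ⟨hPM, hPN⟩, fun R ⟨hRM, hRN⟩ => QHarm.eq_of_laplacian_eq_of_eval_eq hB hdet' hc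
      (hRM.trans hPM.symm) fun v hv => (hRN v hv).trans (hPN v hv).symm⟩
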